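/- **Setting.** Let $\mathcal M$ be a metric space, $c>1$, $r>0$. For a finite dataset $S\subset\mathcal M$ and $q\in\mathcal M$ put $B_S(q,r)=\{p\in S: d(p,q)\le r\}$. In the weak $(c,r)$-decision problem the answer $1$ is required if $B_S(q,r)\ne\emptyset$, the answer $0$ is required if $B_S(q,cr)=\emptyset$, and otherwise both answers are correct. An *oblivious decider* $\mathcal A$ with space $s(n)$ and query time $t(n)$ uses a random string $\sigma$ to store a dataset $S$ of $n$ points in at most $s(n)$ memory cells (for instance bits); afterwards every query $q$ is answered by a program that reads this memory and takes at most $t(n)$ elementary steps, and for every fixed $S$ and fixed $q$ the answer is correct with probability at least $9/10$ over $\sigma$. The algorithm $\mathcal A_{\mathrm{dec}}$ with parameters $L,k$ stores $L$ copies $\mathcal D_1,\dots,\mathcal D_L$ of $\mathcal A$'s data structure for $S$, built with independent random strings. On each query $q$ it draws, freshly and independently, $k$ uniform indices $j_1,\dots,j_k\in\{1,\dots,L\}$ (with replacement) and Laplace noise $Z$ with density $\frac k2 e^{-k|x|}$, and it answers $1$ if $\frac1k\,|\{i:\mathcal D_{j_i}(q)=1\}|+Z>\frac12$ and $0$ otherwise.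 Drawing an index or the noise, updating a counter, translating an address and a comparison are counted as one elementary step each. In the adversarial game an adversary fixes $S$ and then issues $Q\ge1$ queries, each of which may depend on all previous queries and answers; the algorithm fails if at least one of its $Q$ answers is incorrect. The probability of failure is over all the randomness of the algorithm (setup and queries). **Theorem.** There is an absolute constant $C>0$ such that the following holds. Let $\mathcal A$ be an oblivious decider with space $s(n)$ and query time $t(n)$, let $Q\ge 1$, $\varepsilon=0.01$, $0<\delta<\varepsilon/4$, and set $$k=\left\lceil 40\ln(Q/\delta)\right\rceil,\qquad L=\left\lceil 24\,\varepsilon^{-1}\,k\,\sqrt{\ln(1/\delta)}\,\sqrt{2Q}\right\rceil .$$ Then: 1. for every dataset and every adaptive adversary, $\mathcal A_{\mathrm{dec}}$ answers all $Q$ queries correctly with probability at least $1-C\delta$; 2. for every $n$, on datasets of $n$ points $\mathcal A_{\mathrm{dec}}$ stores at most $s(n)\cdot C\sqrt Q\,\ln^{3/2}(Q/\delta)$ memory cells (that is, $s(n)\cdot\widetilde O(\sqrt Q)$); 3. on datasets of $n$ points every query takes at most $C\,t(n)\ln(Q/\delta)$ elementary steps (that is, $\widetilde O(t(n))$), for all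 outcomes of the randomness. -/

import Mathlib

open MeasureTheory
open scoped ENNReal

namespace RobustANN

universe uM uG uC uS uR

/-! ### Query programs with a step count -/

/-- A query program that may read the cells of a stored data structure.  `Cell` is the type of
addresses and `Γ` the alphabet of one cell (`Γ = Bool` for bits).  Every node of the tree is one
unit of time: `step` is one elementary internal operation (arithmetic on indices and counters,
consulting a random source, a comparison), `read c` reads the cell with address `c`, and
`output b` halts with the answer `b` (`true` stands for `1`, `false` for `0`). -/
inductive Program (Cell : Type uC) (Γ : Type uG) : Type (max uC uG) where
  | output (b : Bool) : Program Cell Γ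
  | step (next : Program Cell Γ) : Program Cell Γ
  | read (c : Cell) (next : Γ → Program Cell Γ) : Program Cell Γ

namespace Program

variable {Cell : Type uC} {Cell' : Type uR} {Γ : Type uG}

/-- The answer of a program on the memory contents `mem`. -/
def eval (mem : Cell → Γ) : Program Cell Γ → Bool
  | output b => b
  | step next => eval mem next
  | read c next => eval mem (next (mem c))

/-- The number of units of time that a program spends on the memory contents `mem`. -/
def time (mem : Cell → Γ) : Program Cell Γ → ℕ
  | output _ => 1
  | step next => time mem next + 1
  | read c next => time mem (next (mem c)) + 1

/-- Run `p` as a subroutine on the part of a larger memory whose addresses are given by `addr`,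
then continue with `next` on its answer.  Returning costs one unit of time, and every read costs
one extra unit for translating the address. -/
def call (addr : Cell → Cell') (next : Bool → Program Cell' Γ) :
    Program Cell Γ → Program Cell' Γ
  | output b => step (next b)
  | step p => step (call addr next p)
  | read c p => step (read (addr c) fun v => call addr next (p v))

end Program

/-! ### Weak decision ANN -/

/-- The points of `S` at distance at most `r` from `q`. -/
def ball {M : Type uM} [MetricSpace M] (S : Finset M) (q : M) (r : ℝ) : Set M :=
  {p | p ∈ S ∧ dist p q ≤ r}

/-- The set of correct answers to the weak `(c,r)`-decision problem on `S` and `q`: `1` is required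
if there is a point within distance `r`, `0` is required if there is none within distance `c * r`,
and otherwise both answers are correct. -/
def correctAnswers {M : Type uM} [MetricSpace M] (c r : ℝ) (S : Finset M) (q : M) : Set Bool :=
  {b | ((ball S q r).Nonempty → b = true) ∧ (ball S q (c * r) = ∅ → b = false)}

/-! ### Randomized data structures and the adversarial game -/

/-- A randomized data structure answering yes/no queries on finite datasets `S` of points of `M`.
On setup randomness `σ : Seed`, distributed by `seedLaw`, it stores the memory contents
`build σ S`, whose cells are indexed by `Cell n` for `n = |S|`.  Each query comes with fresh
randomness `ρ : Coins`, distributed by `coinLaw`, and is answered by running the program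
`query n ρ q`, which sees the stored memory only through its reads. -/
structure DataStructure (M : Type uM) (Γ : Type uG) (Cell : ℕ → Type uC) (Seed : Type uS)
    (Coins : Type uR) [MeasurableSpace Seed] [MeasurableSpace Coins] where
  seedLaw : Measure Seed
  coinLaw : Measure Coins
  build : Seed → (S : Finset M) → Cell S.card → Γ
  query : (n : ℕ) → Coins → M → Program (Cell n) Γ

namespace DataStructure

variable {M : Type uM} {Γ : Type uG} {Cell : ℕ → Type uC} {Seed : Type uS} {Coins : Type uR}
  [MeasurableSpace Seed] [MeasurableSpace Coins]

/-- The answer to the query `q` on dataset `S`. -/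
def answer (D : DataStructure M Γ Cell Seed Coins) (S : Finset M) (σ : Seed) (ρ : Coins) (q : M) :
    Bool :=
  (D.query S.card ρ q).eval (D.build σ S)

/-- The time spent on the query `q` on dataset `S`. -/
def queryTime (D : DataStructure M Γ Cell Seed Coins) (S : Finset M) (σ : Seed) (ρ : Coins)
    (q : M) : ℕ :=
  (D.query S.card ρ q).time (D.build σ S)

/-- The number of memory cells stored for a dataset of `n` points. -/
def space [∀ n, Fintype (Cell n)] (_D : DataStructure M Γ Cell Seed Coins) (n : ℕ) : ℕ :=
  Fintype.card (Cell n)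

/-- The query phase of the game against the adversary strategy `B`, which maps the history of all
previous (query, answer) pairs to the next query.  The list contains the fresh randomness of the
remaining rounds, `h` is the history so far; the result is the complete transcript. -/
def play (D : DataStructure M Γ Cell Seed Coins) (S : Finset M) (B : List (M × Bool) → M)
    (σ : Seed) : List Coins → List (M × Bool) → List (M × Bool)
  | [], h => h
  | ρ :: rest, h => play D S B σ rest (h ++ [(B h, D.answer S σ ρ (B h))])

variable [MetricSpace M]

/-- For every dataset and every adaptive strategy of `Q` queries, the probability that some answer
is incorrect is at most `η`.  The probability is over the setup randomness and the independent
fresh randomness of the `Q` rounds. -/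
def IsAdversariallyRobust (D : DataStructure M Γ Cell Seed Coins) (c r : ℝ) (Q : ℕ) (η : ℝ) :
    Prop :=
  ∀ (S : Finset M) (B : List (M × Bool) → M),
    (D.seedLaw.prod (Measure.pi fun _ : Fin Q => D.coinLaw))
      {ω : Seed × (Fin Q → Coins) |
        ∃ e ∈ D.play S B ω.1 (List.ofFn ω.2) [], e.2 ∉ correctAnswers c r S e.1} ≤
      ENNReal.ofReal η

/-- An oblivious decider, whose queries use no randomness beyond the setup randomness: on every
fixed dataset and fixed query it answers correctly with probability at least `9/10`. -/
def IsObliviousDecider (A : DataStructure M Γ Cell Seed Unit) (c r : ℝ) : Prop :=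
  ∀ (S : Finset M) (q : M),
    (9 / 10 : ℝ≥0∞) ≤ A.seedLaw {σ | A.answer S σ () q ∈ correctAnswers c r S q}

end DataStructure

/-! ### The robust decider -/

/-- The Laplace distribution on `ℝ` with mean `0` and scale `b`. -/
noncomputable def laplace (b : ℝ) : Measure ℝ :=
  volume.withDensity fun x => ENNReal.ofReal (1 / (2 * b) * Real.exp (-|x| / b))

/-- Go through the list of sampled indices and count the answers `1`: fetch the next index `j` (one
step), run `p` on the `j`-th copy, update the counter (one step); finally run `finish` on the
count. -/
def tally {L : ℕ} {Cell : Type uC} {Γ : Type uG} (p : Program Cell Γ)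
    (finish : ℕ → Program (Fin L × Cell) Γ) : List (Fin L) → ℕ → Program (Fin L × Cell) Γ
  | [], N => finish N
  | j :: js, N =>
    .step (p.call (fun x => (j, x)) fun b =>
      .step (tally p finish js (if b then N + 1 else N)))

/-- The robust decider built from `L` independent copies of `A`.  The fresh randomness of a query
consists of `k` indices of copies, independent and uniform (with replacement), and of noise `z`
with law `Lap(1/k)`.  The answer is `1` if and only if `N / k + z > 1/2`, where `N` is the number
of sampled copies that answer `1`; fetching the noise and comparing cost one step each. -/
noncomputable def robustDecider {M : Type uM} {Γ : Type uG} {Cell : ℕ → Type uC} {Seed : Type uS}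
    [MeasurableSpace Seed] (A : DataStructure M Γ Cell Seed Unit) (L k : ℕ) :
    DataStructure M Γ (fun n => Fin L × Cell n) (Fin L → Seed) ((Fin k → Fin L) × ℝ) where
  seedLaw := Measure.pi fun _ => A.seedLaw
  coinLaw :=
    (Measure.pi fun _ => ProbabilityTheory.uniformOn (Set.univ : Set (Fin L))).prod
      (laplace (1 / (k : ℝ)))
  build := fun σ S x => A.build (σ x.1) S x.2
  query := fun n ρ q =>
    tally (A.query n () q)
      (fun N => .step (.step (.output (decide ((1 / 2 : ℝ) < (N : ℝ) / (k : ℝ) + ρ.2)))))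
      (List.ofFn ρ.1) 0

end RobustANN

namespace RobustANN

/-! ### Sums over answer sequences -/

/-! The adversary is deterministic, so each query is a function of the preceding answers. Once the
answers of the copies on the finitely many possible queries are fixed, as a vector `v` of `L`
independent finite vectors, the probability of an answer sequence is a product of one-round
probabilities (`pathWeight`). A round can go wrong in two ways: at least 35% of the copies are wrong
on the query, or fewer are wrong but the noisy sampled vote fails. The second has probability at
most `exp (-k / 40)` per round by a Chernoff bound, and a union bound over rounds finishes it.

The first is an adaptivity problem, handled by a privacy argument. Noise of scale `1 / k` makes the
law of one answer log-Lipschitz, with constant `2 * k`, in the fraction of copies voting `1`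
(`isLogLipschitz_answerProb`). Resampling a set `A` of `m` copies moves that fraction by at most `m
/ L`, so the order-two Rényi divergence grows only like `Q * (k * m / L) ^ 2` over the whole game
(`sum_sq_div_le`, `sum_pathWeight_sq_div_le`). This quadratic dependence is why about `√Q` copies
suffice.

Now select a round by a softmax on the number of bad copies, a choice that is also stable under
resampling. Were the copies in `A` independent of the answers, all of them would be bad in the
selected round with probability at most `0.1 ^ m`. The divergence bound transfers this to the true
game with `0.1 ^ m` weakened to about `0.32 ^ m` (`sum_softBad_le`). Summing over all `A` of size
`m` bounds a binomial moment of the number of bad copies. A round with 35% bad copies would make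
this moment at least of order `(0.33 * L) ^ m / m!`, so by Markov such a round is exponentially
unlikely in `m` (`sum_exists_bad_le`). Taking `m` of order `log (1 / δ)` gives failure probability
`O(δ)`. -/

/-- The first `i` letters of a sequence of answers. -/
def answerPrefix {n : ℕ} (a : Fin n → Bool) (i : ℕ) : List Bool := (List.ofFn a).take i

/-- The weight of a sequence of answers, given the weight of every next answer after each
prefix. -/
noncomputable def pathWeight {n : ℕ} (φ : List Bool → Bool → ℝ) (a : Fin n → Bool) : ℝ :=
  ∏ i : Fin n, φ (answerPrefix a i) (a i)

lemma answerPrefix_cons_succ {n : ℕ} (b : Bool) (a : Fin n → Bool) (i : ℕ) :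
    answerPrefix (Fin.cons b a : Fin (n + 1) → Bool) (i + 1) = b :: answerPrefix a i := by
  simp [answerPrefix, List.ofFn_succ]

lemma answerPrefix_zero {n : ℕ} (a : Fin n → Bool) : answerPrefix a 0 = [] := by
  simp [answerPrefix]

lemma pathWeight_cons {n : ℕ} (φ : List Bool → Bool → ℝ) (b : Bool) (a : Fin n → Bool) :
    pathWeight φ (Fin.cons b a : Fin (n + 1) → Bool) =
      φ [] b * pathWeight (fun l => φ (b :: l)) a := by
  simp [pathWeight, Fin.prod_univ_succ, answerPrefix_cons_succ, answerPrefix_zero]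

lemma pathWeight_nonneg {n : ℕ} {φ : List Bool → Bool → ℝ} (h : ∀ l b, 0 ≤ φ l b)
    (a : Fin n → Bool) : 0 ≤ pathWeight φ a :=
  Finset.prod_nonneg fun _ _ => h _ _

lemma sum_answers_cons {n : ℕ} (f : (Fin (n + 1) → Bool) → ℝ) :
    ∑ a, f a = ∑ b : Bool, ∑ a : Fin n → Bool, f (Fin.cons b a) := by
  rw [← (Fin.consEquiv fun _ => Bool).sum_comp, Fintype.sum_prod_type]
  rfl

/-- Peel off the first round: the bound on the remaining rounds is uniform in its outcome. With `c =
1` this bounds the total mass; with squared ratios as weights it is the adaptive composition of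
Rényi divergences. -/
lemma sum_pathWeight_le {c : ℝ} (hc : 0 ≤ c) (n : ℕ) :
    ∀ φ : List Bool → Bool → ℝ, (∀ l b, 0 ≤ φ l b) → (∀ l, ∑ b, φ l b ≤ c) →
      ∑ a : Fin n → Bool, pathWeight φ a ≤ c ^ n := by
  induction n with
  | zero => intro φ _ _; simp [pathWeight]
  | succ n ih =>
    intro φ h0 h1
    rw [sum_answers_cons]
    simp_rw [pathWeight_cons, ← Finset.mul_sum]
    calc ∑ b, φ [] b * ∑ a : Fin n → Bool, pathWeight (fun l => φ (b :: l)) a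
        ≤ ∑ b, φ [] b * c ^ n := by
          gcongr with b
          · exact h0 _ _
          · exact ih _ (fun _ _ => h0 _ _) fun _ => h1 _
      _ = (∑ b, φ [] b) * c ^ n := by rw [Finset.sum_mul]
      _ ≤ c * c ^ n := by gcongr; exact h1 _
      _ = c ^ (n + 1) := by ring

open Classical in
/-- A union bound over the rounds: if after every prefix the next answer lies in `E` with
probability at most `η`, then some answer does so with probability at most `n * η`. -/
lemma sum_pathWeight_exists_le {η : ℝ} (n : ℕ) :
    ∀ (φ : List Bool → Bool → ℝ) (E : List Bool → Bool → Prop), (∀ l b, 0 ≤ φ l b) →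
      (∀ l, ∑ b, φ l b ≤ 1) → (∀ l, ∑ b, (if E l b then φ l b else 0) ≤ η) →
      ∑ a : Fin n → Bool, (if ∃ i : Fin n, E (answerPrefix a i) (a i) then pathWeight φ a else 0) ≤
        n * η := by
  induction n with
  | zero => intro φ E _ _ _; simp
  | succ n ih =>
    intro φ E h0 h1 h2
    have hη : 0 ≤ η := le_trans (Finset.sum_nonneg fun b _ => by split_ifs <;> simp [h0]) (h2 [])
    rw [sum_answers_cons]
    calc _ ≤ ∑ b, ∑ a : Fin n → Bool, ((if E [] b then φ [] b else 0) *
              pathWeight (fun l => φ (b :: l)) a + φ [] b *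
              (if ∃ i : Fin n, E (b :: answerPrefix a i) (a i) then
                pathWeight (fun l => φ (b :: l)) a else 0)) := by
          refine Finset.sum_le_sum fun b _ => Finset.sum_le_sum fun a _ => ?_
          have hp := pathWeight_nonneg (φ := fun l => φ (b :: l)) (fun _ _ => h0 _ _) a
          have hb := h0 [] b
          have hm := mul_nonneg hb hp
          simp only [Fin.exists_fin_succ, Fin.val_zero, Fin.val_succ, answerPrefix_cons_succ,
            answerPrefix_zero, Fin.cons_zero, Fin.cons_succ, pathWeight_cons]
          by_cases e1 : E [] b <;>
            by_cases e2 : ∃ i : Fin n, E (b :: answerPrefix a i) (a i) <;> simp [e1, e2]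
          all_goals linarith
      _ = (∑ b, (if E [] b then φ [] b else 0) *
              ∑ a : Fin n → Bool, pathWeight (fun l => φ (b :: l)) a) + ∑ b, φ [] b *
              ∑ a : Fin n → Bool, (if ∃ i : Fin n, E (b :: answerPrefix a i) (a i) then
                pathWeight (fun l => φ (b :: l)) a else 0) := by
          simp_rw [Finset.sum_add_distrib, Finset.mul_sum]
      _ ≤ (∑ b, (if E [] b then φ [] b else 0) * 1) + ∑ b, φ [] b * (n * η) := by
          gcongr with b _ b _
          · split_ifs <;> simp [h0]
          · simpa using sum_pathWeight_le zero_le_one n (fun l => φ (b :: l))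
              (fun _ _ => h0 _ _) fun _ => h1 _
          · exact h0 _ _
          · exact ih _ (fun l => E (b :: l)) (fun _ _ => h0 _ _) (fun _ => h1 _) fun _ => h2 _
      _ ≤ η + 1 * (n * η) := by
          rw [← Finset.sum_mul, ← Finset.sum_mul, mul_one]
          gcongr
          · exact h2 _
          · exact h1 _
      _ = _ := by push_cast; ring

/-! ### Product weights and resampling -/

section Resample

variable {Y : Type*} {L : ℕ}

/-- The product weight of a vector. -/
noncomputable def prodWeight (w : Y → ℝ) (v : Fin L → Y) : ℝ := ∏ l, w (v l)

lemma prodWeight_nonneg {w : Y → ℝ} (hw : ∀ y, 0 ≤ w y) (v : Fin L → Y) : 0 ≤ prodWeight w v :=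
  Finset.prod_nonneg fun _ _ => hw _

lemma sum_prodWeight [Fintype Y] {w : Y → ℝ} (hw : ∑ y, w y = 1) :
    ∑ v : Fin L → Y, prodWeight w v = 1 := by
  have h := Finset.prod_univ_sum (fun _ : Fin L => (Finset.univ : Finset Y)) fun _ y => w y
  simp only [Fintype.piFinset_univ] at h
  simp only [prodWeight]
  rw [← h]
  simp [hw]

/-- The vector `v` with the coordinates in `A` replaced by those of `v'`. -/
def splice (A : Finset (Fin L)) (v v' : Fin L → Y) : Fin L → Y :=
  fun l => if l ∈ A then v' l else v l

open Classical in
lemma sum_prodWeight_forall_mem_le [Fintype Y] {w : Y → ℝ} (hw0 : ∀ y, 0 ≤ w y)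
    (hw : ∑ y, w y = 1) {P : Y → Prop} {c : ℝ} (hP : ∑ y, (if P y then w y else 0) ≤ c)
    (A : Finset (Fin L)) :
    ∑ v : Fin L → Y, (if ∀ l ∈ A, P (v l) then prodWeight w v else 0) ≤ c ^ A.card := by
  have h := Finset.prod_univ_sum (fun _ : Fin L => (Finset.univ : Finset Y))
    fun l y => if l ∈ A → P y then w y else 0
  simp only [Fintype.piFinset_univ] at h
  have h2 : ∀ v : Fin L → Y, (if ∀ l ∈ A, P (v l) then prodWeight w v else 0) =
      ∏ l, if l ∈ A → P (v l) then w (v l) else 0 := by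
    intro v
    by_cases hv : ∀ l ∈ A, P (v l)
    · rw [if_pos hv]
      exact Finset.prod_congr rfl fun l _ => (if_pos (hv l)).symm
    · rw [if_neg hv]
      push Not at hv
      obtain ⟨l, hl, hl'⟩ := hv
      refine (Finset.prod_eq_zero (Finset.mem_univ l) ?_).symm
      rw [if_neg]
      exact fun h => hl' (h hl)
  simp_rw [h2]
  rw [← h]
  calc _ ≤ ∏ l : Fin L, (if l ∈ A then c else 1) := by
        refine Finset.prod_le_prod (fun l _ => Finset.sum_nonneg fun y _ => ?_) fun l _ => ?_
        · split_ifs <;> simp [hw0]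
        · by_cases hl : l ∈ A <;> simp [hl, hP, hw]
    _ = c ^ A.card := by simp [Finset.prod_ite_mem]

/-- Exchanging the coordinates in `A` of two independent vectors does not change their law. -/
lemma sum_prodWeight_swap [Fintype Y] (w : Y → ℝ) (A : Finset (Fin L))
    (F : (Fin L → Y) → (Fin L → Y) → ℝ) :
    ∑ v, ∑ v', prodWeight w v * prodWeight w v' * F (splice A v v') (splice A v' v) =
      ∑ v, ∑ v', prodWeight w v * prodWeight w v' * F v v' := by
  let f : (Fin L → Y) × (Fin L → Y) → (Fin L → Y) × (Fin L → Y) :=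
    fun x => (splice A x.1 x.2, splice A x.2 x.1)
  have hf : Function.Involutive f := by
    intro x
    refine Prod.ext ?_ ?_ <;> funext l <;> by_cases hl : l ∈ A <;> simp [f, splice, hl]
  rw [← Fintype.sum_prod_type', ← Fintype.sum_prod_type',
    ← Equiv.sum_comp hf.toPerm]
  refine Finset.sum_congr rfl fun x _ => ?_
  have h1 : prodWeight w (f x).1 * prodWeight w (f x).2 = prodWeight w x.1 * prodWeight w x.2 := by
    simp only [prodWeight, ← Finset.prod_mul_distrib]
    refine Finset.prod_congr rfl fun l _ => ?_
    by_cases hl : l ∈ A <;> simp [f, splice, hl, mul_comm]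
  have h2 := hf x
  simp only [Function.Involutive.coe_toPerm]
  rw [h1]
  have e1 : splice A (f x).1 (f x).2 = x.1 := congrArg Prod.fst h2
  have e2 : splice A (f x).2 (f x).1 = x.2 := congrArg Prod.snd h2
  rw [e1, e2]

open Classical in
/-- The number of coordinates of `v` with the property `P`. -/
noncomputable def count (P : Y → Prop) (v : Fin L → Y) : ℕ :=
  (Finset.univ.filter fun l => P (v l)).card

lemma count_le (P : Y → Prop) (v : Fin L → Y) : count P v ≤ L := by
  classical
  exact (Finset.card_le_univ _).trans (by simp)

lemma count_le_splice (P : Y → Prop) (A : Finset (Fin L)) (v v' : Fin L → Y) :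
    count P v ≤ count P (splice A v v') + A.card := by
  classical
  rw [count, count, ← tsub_le_iff_right]
  have := Finset.card_le_card (s := (Finset.univ.filter fun l => P (v l)) \ A)
    (t := Finset.univ.filter fun l => P (splice A v v' l)) (by
      intro l hl
      simp only [Finset.mem_sdiff, Finset.mem_filter, Finset.mem_univ, true_and] at hl ⊢
      simpa [splice, hl.2] using hl.1)
  exact (Finset.le_card_sdiff _ _).trans this

lemma splice_count_le (P : Y → Prop) (A : Finset (Fin L)) (v v' : Fin L → Y) :
    count P (splice A v v') ≤ count P v + A.card := by
  have h := count_le_splice P A (splice A v v') v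
  have e : splice A (splice A v v') v = v := by
    funext l; by_cases hl : l ∈ A <;> simp [splice, hl]
  rwa [e] at h

open Classical in
lemma card_powersetCard_filter_forall (P : Y → Prop) (v : Fin L → Y) (m : ℕ) :
    ((Finset.powersetCard m (Finset.univ : Finset (Fin L))).filter
      fun A => ∀ l ∈ A, P (v l)).card = (count P v).choose m := by
  rw [count, ← Finset.card_powersetCard]
  congr 1
  ext A
  simp only [Finset.mem_filter, Finset.mem_powersetCard, true_and,
    Finset.subset_iff, Finset.mem_univ]
  tauto

end Resample

/-! ### Adaptive generalization by privacy -/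

/-- Change of measure from `x` to `y` by AM-GM, a linear form of Cauchy–Schwarz with a free
parameter `θ`. The constant `c` is irrelevant: it only forces `x = 0` where `y = 0`, where the
quotient takes the default value `0`. -/
lemma mul_le_half_of_le_mul {x y f θ c : ℝ} (hx : 0 ≤ x) (hy : 0 ≤ y) (hxy : x ≤ c * y)
    (hθ : 0 < θ) (hf0 : 0 ≤ f) (hf1 : f ≤ 1) :
    x * f ≤ (θ * (x ^ 2 / y) + θ⁻¹ * (y * f)) / 2 := by
  rcases hy.eq_or_lt with rfl | hy
  · have : x = 0 := le_antisymm (by simpa using hxy) hx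
    simp [this]
  · have h : 0 ≤ θ * y * (x / y - θ⁻¹ * f) ^ 2 := by positivity
    have e : θ * y * (x / y - θ⁻¹ * f) ^ 2 = θ * (x ^ 2 / y) + θ⁻¹ * (y * f ^ 2) - 2 * (x * f) := by
      field_simp
      ring
    have h2 : θ⁻¹ * (y * f ^ 2) ≤ θ⁻¹ * (y * f) := by
      gcongr
      nlinarith
    linarith

/-- The Rényi divergence of order two of two laws on `{0,1}` with likelihood ratio at most
`exp s`. -/
lemma sum_sq_div_le {P R : Bool → ℝ} {s : ℝ} (hs : 0 ≤ s) (hP : ∀ b, 0 ≤ P b) (hR : ∀ b, 0 ≤ R b)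
    (hP1 : ∑ b, P b = 1) (hR1 : ∑ b, R b = 1) (hPR : ∀ b, P b ≤ Real.exp s * R b)
    (hRP : ∀ b, R b ≤ Real.exp s * P b) :
    ∑ b, P b ^ 2 / R b ≤ Real.exp (3 * s ^ 2) := by
  -- For `s ≥ 1` the crude bound `exp s` suffices. For `s ≤ 1` the sum is one plus the chi-square
  -- divergence, which is quadratic in `s`.
  rcases le_total 1 s with h1 | h1
  · calc ∑ b, P b ^ 2 / R b ≤ ∑ b, Real.exp s * P b := by
          refine Finset.sum_le_sum fun b _ => ?_
          refine div_le_of_le_mul₀ (hR b) (mul_nonneg (Real.exp_pos _).le (hP b)) ?_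
          nlinarith [mul_le_mul_of_nonneg_left (hPR b) (hP b)]
      _ = Real.exp s := by rw [← Finset.mul_sum, hP1, mul_one]
      _ ≤ _ := Real.exp_le_exp.2 (by nlinarith)
  · have he : Real.exp s - 1 ≤ 1.73 * s := by
      have := convexOn_exp.2 (Set.mem_univ 0) (Set.mem_univ 1) (sub_nonneg.2 h1) hs (by ring)
      simp only [smul_eq_mul, mul_zero, mul_one, zero_add, Real.exp_zero] at this
      nlinarith [Real.exp_one_lt_d9]
    have he0 : 0 ≤ Real.exp s - 1 := by linarith [Real.one_le_exp hs]
    have hem : Real.exp s * Real.exp (-s) = 1 := by rw [← Real.exp_add]; simp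
    -- For `R ≠ 0`, `P² / R = 2 P - R + (P - R)² / R`, and the likelihood ratios give `|P - R| ≤
    -- (exp s - 1) R`. The first-order terms sum to one.
    calc ∑ b, P b ^ 2 / R b ≤ ∑ b, (2 * P b - R b + (Real.exp s - 1) ^ 2 * R b) := by
          refine Finset.sum_le_sum fun b _ => ?_
          have hPb := hP b
          have h3 := hPR b
          have h4 : R b - P b ≤ (Real.exp s - 1) * R b := by
            nlinarith [hRP b, hR b, mul_le_mul_of_nonneg_left (hRP b) (Real.exp_pos (-s)).le,
              Real.exp_pos s, Real.exp_pos (-s)]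
          rcases (hR b).eq_or_lt with h0 | h0
          · rw [← h0] at h3 ⊢
            have : P b = 0 := le_antisymm (by simpa using h3) (hP b)
            simp [this]
          · rw [div_le_iff₀ h0]
            have h5 : (P b - R b) ^ 2 ≤ ((Real.exp s - 1) * R b) ^ 2 :=
              sq_le_sq' (by linarith) (by linarith)
            nlinarith
      _ = 1 + (Real.exp s - 1) ^ 2 := by
          rw [Finset.sum_add_distrib, Finset.sum_sub_distrib, ← Finset.mul_sum, ← Finset.mul_sum,
            hP1, hR1]
          ring
      _ ≤ 3 * s ^ 2 + 1 := by nlinarith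
      _ ≤ _ := Real.add_one_le_exp _

/-! ### Stability of the answers and of the softmax selection under resampling -/

section Core

variable {Y : Type*} {L Q : ℕ}

/-- The weight of the next answer `b`, when a copy answers as prescribed by `X` and the answer has
law `ker · p` if a fraction `p` of the copies answers `1`. -/
noncomputable def voteWeight (ker : Bool → ℝ → ℝ) (X : List Bool → Y → Bool) (v : Fin L → Y)
    (l : List Bool) (b : Bool) : ℝ :=
  ker b (count (fun y => X l y = true) v / L)

/-- A family of laws on `{0,1}`, with logarithms Lipschitz in the parameter `p`. -/
structure IsLogLipschitz (ker : Bool → ℝ → ℝ) (κ : ℝ) : Prop where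
  nonneg : ∀ b, ∀ p ∈ Set.Icc (0 : ℝ) 1, 0 ≤ ker b p
  sum_eq_one : ∀ p ∈ Set.Icc (0 : ℝ) 1, ∑ b, ker b p = 1
  le_exp_mul : ∀ b, ∀ p ∈ Set.Icc (0 : ℝ) 1, ∀ p' ∈ Set.Icc (0 : ℝ) 1,
    ker b p ≤ Real.exp (κ * |p - p'|) * ker b p'

lemma count_div_mem (P : Y → Prop) (v : Fin L → Y) :
    (count P v / L : ℝ) ∈ Set.Icc (0 : ℝ) 1 :=
  ⟨by positivity, div_le_one_of_le₀ (by exact_mod_cast count_le P v) (by positivity)⟩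

lemma abs_count_splice_sub_le (P : Y → Prop) (A : Finset (Fin L)) (v v' : Fin L → Y) :
    |(count P v / L : ℝ) - count P (splice A v v') / L| ≤ A.card / L := by
  rw [← sub_div, abs_div, Nat.abs_cast]
  gcongr
  have h1 : (count P v : ℝ) ≤ count P (splice A v v') + A.card := by
    exact_mod_cast count_le_splice P A v v'
  have h2 : (count P (splice A v v') : ℝ) ≤ count P v + A.card := by
    exact_mod_cast splice_count_le P A v v'
  rw [abs_le]
  constructor <;> linarith

/-- The softmax weight of the round `i` among all rounds, by the number of bad coordinates. -/
noncomputable def softmax (η : ℝ) (bad : List Bool → Y → Prop) (a : Fin Q → Bool) (v : Fin L → Y)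
    (i : Fin Q) : ℝ :=
  Real.exp (η * count (bad (answerPrefix a i)) v) /
    ∑ j : Fin Q, Real.exp (η * count (bad (answerPrefix a j)) v)

lemma softmax_nonneg (η : ℝ) (bad : List Bool → Y → Prop) (a : Fin Q → Bool) (v : Fin L → Y)
    (i : Fin Q) : 0 ≤ softmax η bad a v i := by
  unfold softmax; positivity

lemma sum_softmax_le (η : ℝ) (bad : List Bool → Y → Prop) (a : Fin Q → Bool) (v : Fin L → Y) :
    ∑ i, softmax η bad a v i ≤ 1 := by
  simp only [softmax, ← Finset.sum_div]
  exact div_self_le_one _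

/-- Replacing the coordinates in `A` changes each count by at most `A.card`. The numerator and the
normalizing sum each contribute one factor `exp (η * A.card)`. -/
lemma softmax_le_splice {η : ℝ} (hη : 0 ≤ η) (bad : List Bool → Y → Prop) (a : Fin Q → Bool)
    (v v' : Fin L → Y) (A : Finset (Fin L)) (i : Fin Q) :
    softmax η bad a v i ≤ Real.exp (2 * η * A.card) * softmax η bad a (splice A v v') i := by
  have h1 : ∀ j : Fin Q, Real.exp (η * count (bad (answerPrefix a j)) v) ≤
      Real.exp (η * A.card) * Real.exp (η * count (bad (answerPrefix a j)) (splice A v v')) := by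
    intro j
    rw [← Real.exp_add, ← mul_add]
    gcongr
    have : (count (bad (answerPrefix a j)) v : ℝ) ≤
      count (bad (answerPrefix a j)) (splice A v v') + A.card := by
        exact_mod_cast count_le_splice _ A v v'
    linarith
  have h2 : ∀ j : Fin Q, Real.exp (η * count (bad (answerPrefix a j)) (splice A v v')) ≤
      Real.exp (η * A.card) * Real.exp (η * count (bad (answerPrefix a j)) v) := by
    intro j
    rw [← Real.exp_add, ← mul_add]
    gcongr
    have : (count (bad (answerPrefix a j)) (splice A v v') : ℝ) ≤
      count (bad (answerPrefix a j)) v + A.card := by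
        exact_mod_cast splice_count_le _ A v v'
    linarith
  have h3 : ∑ j : Fin Q, Real.exp (η * count (bad (answerPrefix a j)) (splice A v v')) ≤
      Real.exp (η * A.card) * ∑ j : Fin Q, Real.exp (η * count (bad (answerPrefix a j)) v) := by
    rw [Finset.mul_sum]
    exact Finset.sum_le_sum fun j _ => h2 j
  have p1 : 0 < ∑ j : Fin Q, Real.exp (η * count (bad (answerPrefix a j)) v) :=
    Finset.sum_pos (fun _ _ => Real.exp_pos _) ⟨i, Finset.mem_univ _⟩
  have p2 : 0 < ∑ j : Fin Q, Real.exp (η * count (bad (answerPrefix a j)) (splice A v v')) :=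
    Finset.sum_pos (fun _ _ => Real.exp_pos _) ⟨i, Finset.mem_univ _⟩
  have e : Real.exp (2 * η * A.card) = Real.exp (η * A.card) * Real.exp (η * A.card) := by
    rw [← Real.exp_add]; ring_nf
  unfold softmax
  rw [e, div_le_iff₀ p1, mul_div_assoc', div_mul_eq_mul_div, le_div_iff₀ p2]
  calc _ ≤ (Real.exp (η * A.card) *
          Real.exp (η * count (bad (answerPrefix a i)) (splice A v v'))) *
        (Real.exp (η * A.card) * ∑ j : Fin Q, Real.exp (η * count (bad (answerPrefix a j)) v)) := by
        gcongr
        exact h1 i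
    _ = _ := by ring

open Classical in
/-- The softmax average of the indicators that all coordinates in `A` are bad. -/
noncomputable def softBad (η : ℝ) (bad : List Bool → Y → Prop) (A : Finset (Fin L))
    (a : Fin Q → Bool) (v u : Fin L → Y) : ℝ :=
  ∑ i, softmax η bad a v i * (if ∀ l ∈ A, bad (answerPrefix a i) (u l) then 1 else 0)

lemma softBad_nonneg (η : ℝ) (bad : List Bool → Y → Prop) (A : Finset (Fin L))
    (a : Fin Q → Bool) (v u : Fin L → Y) : 0 ≤ softBad η bad A a v u :=
  Finset.sum_nonneg fun i _ => mul_nonneg (softmax_nonneg _ _ _ _ _) (by split_ifs <;> simp)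

lemma softBad_le_one (η : ℝ) (bad : List Bool → Y → Prop) (A : Finset (Fin L))
    (a : Fin Q → Bool) (v u : Fin L → Y) : softBad η bad A a v u ≤ 1 :=
  (Finset.sum_le_sum fun i _ => mul_le_of_le_one_right (softmax_nonneg _ _ _ _ _)
    (by split_ifs <;> simp)).trans (sum_softmax_le η bad a v)

lemma softBad_le_splice {η : ℝ} (hη : 0 ≤ η) (bad : List Bool → Y → Prop) (A : Finset (Fin L))
    (a : Fin Q → Bool) (v v' u : Fin L → Y) :
    softBad η bad A a v u ≤ Real.exp (2 * η * A.card) * softBad η bad A a (splice A v v') u := by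
  unfold softBad
  rw [Finset.mul_sum]
  refine Finset.sum_le_sum fun i _ => ?_
  rw [← mul_assoc]
  exact mul_le_mul_of_nonneg_right (softmax_le_splice hη bad a v v' A i) (by split_ifs <;> simp)

variable {ker : Bool → ℝ → ℝ} {κ : ℝ} {X : List Bool → Y → Bool}

lemma voteWeight_nonneg (hk : IsLogLipschitz ker κ) (v : Fin L → Y) (l : List Bool) (b : Bool) :
    0 ≤ voteWeight ker X v l b :=
  hk.nonneg _ _ (count_div_mem _ _)

lemma sum_voteWeight (hk : IsLogLipschitz ker κ) (v : Fin L → Y) (l : List Bool) :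
    ∑ b, voteWeight ker X v l b = 1 :=
  hk.sum_eq_one _ (count_div_mem _ _)

lemma voteWeight_le_splice (hκ : 0 ≤ κ) (hk : IsLogLipschitz ker κ) (A : Finset (Fin L))
    (v v' : Fin L → Y) (l : List Bool) (b : Bool) :
    voteWeight ker X v l b ≤
      Real.exp (κ * (A.card / L)) * voteWeight ker X (splice A v v') l b := by
  refine (hk.le_exp_mul b _ (count_div_mem _ _) _
    (count_div_mem (fun y => X l y = true) (splice A v v'))).trans ?_
  refine mul_le_mul_of_nonneg_right ?_ (voteWeight_nonneg hk _ _ _)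
  gcongr
  exact abs_count_splice_sub_le _ _ _ _

lemma voteWeight_splice_le (hκ : 0 ≤ κ) (hk : IsLogLipschitz ker κ) (A : Finset (Fin L))
    (v v' : Fin L → Y) (l : List Bool) (b : Bool) :
    voteWeight ker X (splice A v v') l b ≤
      Real.exp (κ * (A.card / L)) * voteWeight ker X v l b := by
  refine (hk.le_exp_mul b _ (count_div_mem _ _) _
    (count_div_mem (fun y => X l y = true) v)).trans ?_
  refine mul_le_mul_of_nonneg_right ?_ (voteWeight_nonneg hk _ _ _)
  gcongr
  rw [abs_sub_comm]
  exact abs_count_splice_sub_le _ _ _ _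

/-- The Rényi divergence of order two of the laws of the answers before and after resampling. -/
lemma sum_pathWeight_sq_div_le (hκ : 0 ≤ κ) (hk : IsLogLipschitz ker κ) (A : Finset (Fin L))
    (v v' : Fin L → Y) :
    ∑ a : Fin Q → Bool, pathWeight (voteWeight ker X v) a ^ 2 /
        pathWeight (voteWeight ker X (splice A v v')) a ≤
      Real.exp (3 * (κ * (A.card / L)) ^ 2) ^ Q := by
  have h := sum_pathWeight_le (Real.exp_pos (3 * (κ * (A.card / L)) ^ 2)).le Q
    (fun l b => voteWeight ker X v l b ^ 2 / voteWeight ker X (splice A v v') l b)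
    (fun l b => div_nonneg (sq_nonneg _) (voteWeight_nonneg hk _ _ _))
    (fun l => sum_sq_div_le (by positivity) (voteWeight_nonneg hk v l)
      (voteWeight_nonneg hk _ l) (sum_voteWeight hk v l) (sum_voteWeight hk _ l)
      (voteWeight_le_splice hκ hk A v v' l) (voteWeight_splice_le hκ hk A v v' l))
  simpa [pathWeight, Finset.prod_div_distrib, Finset.prod_pow] using h

/-- This serves only as absolute continuity in the change of measure, so a factor exponential in `Q`
is harmless. -/
lemma pathWeight_le_splice (hκ : 0 ≤ κ) (hk : IsLogLipschitz ker κ) (A : Finset (Fin L))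
    (v v' : Fin L → Y) (a : Fin Q → Bool) :
    pathWeight (voteWeight ker X v) a ≤ Real.exp (κ * (A.card / L)) ^ Q *
      pathWeight (voteWeight ker X (splice A v v')) a := by
  unfold pathWeight
  calc _ ≤ ∏ i : Fin Q, Real.exp (κ * (A.card / L)) *
        voteWeight ker X (splice A v v') (answerPrefix a i) (a i) :=
      Finset.prod_le_prod (fun i _ => voteWeight_nonneg hk _ _ _)
        fun i _ => voteWeight_le_splice hκ hk A v v' _ _
    _ = _ := by simp [Finset.prod_mul_distrib]

variable [Fintype Y] {w : Y → ℝ} {bad : List Bool → Y → Prop}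

open Classical in
/-- The softmax average that all coordinates in `A` are bad, when the coordinates in `A` are
independent of the answers. -/
lemma sum_softBad_indep_le (hw0 : ∀ y, 0 ≤ w y) (hw1 : ∑ y, w y = 1)
    (hk : IsLogLipschitz ker κ) {β : ℝ} (hβ : 0 ≤ β)
    (hbad : ∀ (a : Fin Q → Bool) (i : Fin Q),
      ∑ y, (if bad (answerPrefix a i) y then w y else 0) ≤ β) (η : ℝ) (A : Finset (Fin L)) :
    ∑ v : Fin L → Y, ∑ v', prodWeight w v * prodWeight w v' *
        ∑ a : Fin Q → Bool, pathWeight (voteWeight ker X v) a * softBad η bad A a v v' ≤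
      β ^ A.card := by
  -- Given `v` and `a` the selected round is independent of `v'`, so `v'` can be averaged first,
  -- separately for each candidate round.
  have key : ∀ (v : Fin L → Y) (a : Fin Q → Bool),
      ∑ v', prodWeight w v' * softBad η bad A a v v' ≤ β ^ A.card := by
    intro v a
    calc ∑ v', prodWeight w v' * softBad η bad A a v v'
        = ∑ i, softmax η bad a v i * ∑ v' : Fin L → Y,
            (if ∀ l ∈ A, bad (answerPrefix a i) (v' l) then prodWeight w v' else 0) := by
          simp only [softBad, Finset.mul_sum]
          rw [Finset.sum_comm]
          refine Finset.sum_congr rfl fun i _ => Finset.sum_congr rfl fun v' _ => ?_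
          split_ifs <;> ring
      _ ≤ ∑ i, softmax η bad a v i * β ^ A.card := by
          gcongr with i
          · exact softmax_nonneg _ _ _ _ _
          · exact sum_prodWeight_forall_mem_le hw0 hw1 (hbad a i) A
      _ = (∑ i, softmax η bad a v i) * β ^ A.card := by rw [Finset.sum_mul]
      _ ≤ 1 * β ^ A.card := by gcongr; exact sum_softmax_le _ _ _ _
      _ = _ := one_mul _
  calc _ = ∑ v : Fin L → Y, prodWeight w v * ∑ a : Fin Q → Bool,
          pathWeight (voteWeight ker X v) a * ∑ v', prodWeight w v' * softBad η bad A a v v' := by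
        refine Finset.sum_congr rfl fun v _ => ?_
        simp only [Finset.mul_sum]
        rw [Finset.sum_comm]
        exact Finset.sum_congr rfl fun a _ => Finset.sum_congr rfl fun v' _ => by ring
    _ ≤ ∑ v : Fin L → Y, prodWeight w v * ∑ a : Fin Q → Bool,
          pathWeight (voteWeight ker X v) a * β ^ A.card := by
        gcongr with v _ a _
        · exact prodWeight_nonneg hw0 v
        · exact pathWeight_nonneg (voteWeight_nonneg hk v) a
        · exact key v a
    _ ≤ ∑ v : Fin L → Y, prodWeight w v * β ^ A.card := by
        gcongr with v _
        · exact prodWeight_nonneg hw0 v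
        · rw [← Finset.sum_mul]
          have := sum_pathWeight_le zero_le_one Q (voteWeight ker X v) (voteWeight_nonneg hk v)
            fun l => (sum_voteWeight hk v l).le
          rw [one_pow] at this
          exact mul_le_of_le_one_left (by positivity) this
    _ = β ^ A.card := by rw [← Finset.sum_mul, sum_prodWeight hw1, one_mul]

/-- The softmax average that all coordinates in `A` are bad. -/
lemma sum_softBad_le (hκ : 0 ≤ κ) (hw0 : ∀ y, 0 ≤ w y) (hw1 : ∑ y, w y = 1)
    (hk : IsLogLipschitz ker κ) {β : ℝ} (hβ : 0 ≤ β)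
    (hbad : ∀ (a : Fin Q → Bool) (i : Fin Q),
      ∑ y, (open Classical in if bad (answerPrefix a i) y then w y else 0) ≤ β)
    {η θ : ℝ} (hη : 0 ≤ η) (hθ : 0 < θ) (A : Finset (Fin L)) :
    ∑ v : Fin L → Y, prodWeight w v *
        ∑ a : Fin Q → Bool, pathWeight (voteWeight ker X v) a * softBad η bad A a v v ≤
      (θ * Real.exp (3 * (κ * (A.card / L)) ^ 2) ^ Q +
        θ⁻¹ * (Real.exp (2 * η * A.card) * β ^ A.card)) / 2 := by
  have hW := fun v => prodWeight_nonneg (L := L) hw0 v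
  set E := Real.exp (3 * (κ * (A.card / L)) ^ 2) ^ Q
  have key : ∀ v v' : Fin L → Y,
      ∑ a : Fin Q → Bool, pathWeight (voteWeight ker X v) a * softBad η bad A a v v ≤
        (θ * E + θ⁻¹ * (Real.exp (2 * η * A.card) *
          ∑ a : Fin Q → Bool, pathWeight (voteWeight ker X (splice A v v')) a *
            softBad η bad A a (splice A v v') (splice A v' v))) / 2 := by
    intro v v'
    -- On `A` the vector `splice A v' v` agrees with `v`, and the indicator inspects only these
    -- coordinates.
    have e : ∀ a : Fin Q → Bool, softBad η bad A a (splice A v v') (splice A v' v) =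
        softBad η bad A a (splice A v v') v := by
      intro a
      unfold softBad
      refine Finset.sum_congr rfl fun i _ => ?_
      congr 2
      refine propext (forall₂_congr fun l hl => ?_)
      simp [splice, hl]
    simp only [e]
    calc _ ≤ ∑ a : Fin Q → Bool, (θ * (pathWeight (voteWeight ker X v) a ^ 2 /
              pathWeight (voteWeight ker X (splice A v v')) a) +
            θ⁻¹ * (pathWeight (voteWeight ker X (splice A v v')) a *
              softBad η bad A a v v)) / 2 :=
          Finset.sum_le_sum fun a _ => mul_le_half_of_le_mul
            (pathWeight_nonneg (voteWeight_nonneg hk _) a)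
            (pathWeight_nonneg (voteWeight_nonneg hk _) a)
            (pathWeight_le_splice hκ hk A v v' a) hθ (softBad_nonneg _ _ _ _ _ _)
            (softBad_le_one _ _ _ _ _ _)
      _ ≤ ∑ a : Fin Q → Bool, (θ * (pathWeight (voteWeight ker X v) a ^ 2 /
              pathWeight (voteWeight ker X (splice A v v')) a) +
            θ⁻¹ * (pathWeight (voteWeight ker X (splice A v v')) a *
              (Real.exp (2 * η * A.card) * softBad η bad A a (splice A v v') v))) / 2 := by
          gcongr with a _
          · exact pathWeight_nonneg (voteWeight_nonneg hk _) a
          · exact softBad_le_splice hη bad A a v v' v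
      _ = (θ * ∑ a : Fin Q → Bool, (pathWeight (voteWeight ker X v) a ^ 2 /
              pathWeight (voteWeight ker X (splice A v v')) a) +
            θ⁻¹ * (Real.exp (2 * η * A.card) * ∑ a : Fin Q → Bool,
              pathWeight (voteWeight ker X (splice A v v')) a *
              softBad η bad A a (splice A v v') v)) / 2 := by
          rw [← Finset.sum_div, Finset.sum_add_distrib, Finset.mul_sum, Finset.mul_sum,
            Finset.mul_sum]
          congr 2
          exact Finset.sum_congr rfl fun a _ => by ring
      _ ≤ _ := by
          gcongr
          exact sum_pathWeight_sq_div_le hκ hk A v v'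
  -- Exchanging the `A`-coordinates preserves the joint law. After the exchange, answers and
  -- selection depend on `v` alone while badness is tested on the independent vector `v'`.
  have swap := sum_prodWeight_swap w A fun v v' : Fin L → Y =>
    ∑ a : Fin Q → Bool, pathWeight (voteWeight ker X v) a * softBad η bad A a v v'
  have one : ∑ v : Fin L → Y, prodWeight w v = 1 := sum_prodWeight hw1
  have one2 : ∑ v : Fin L → Y, ∑ v' : Fin L → Y, prodWeight w v * prodWeight w v' = 1 := by
    simp only [← Finset.mul_sum, one, mul_one]
  calc ∑ v : Fin L → Y, prodWeight w v *
        ∑ a : Fin Q → Bool, pathWeight (voteWeight ker X v) a * softBad η bad A a v v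
      = ∑ v : Fin L → Y, ∑ v' : Fin L → Y, prodWeight w v * prodWeight w v' *
        ∑ a : Fin Q → Bool, pathWeight (voteWeight ker X v) a * softBad η bad A a v v := by
        refine Finset.sum_congr rfl fun v _ => ?_
        rw [← Finset.sum_mul, ← Finset.mul_sum, one, mul_one]
    _ ≤ ∑ v : Fin L → Y, ∑ v' : Fin L → Y, prodWeight w v * prodWeight w v' *
        ((θ * E + θ⁻¹ * (Real.exp (2 * η * A.card) *
          ∑ a : Fin Q → Bool, pathWeight (voteWeight ker X (splice A v v')) a *
            softBad η bad A a (splice A v v') (splice A v' v))) / 2) := by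
        gcongr with v _ v' _
        · exact mul_nonneg (hW v) (hW v')
        · exact key v v'
    _ = (θ * E * (∑ v : Fin L → Y, ∑ v' : Fin L → Y, prodWeight w v * prodWeight w v') +
          θ⁻¹ * (Real.exp (2 * η * A.card) * ∑ v : Fin L → Y, ∑ v' : Fin L → Y,
          prodWeight w v * prodWeight w v' *
          ∑ a : Fin Q → Bool, pathWeight (voteWeight ker X (splice A v v')) a *
            softBad η bad A a (splice A v v') (splice A v' v))) / 2 := by
        simp only [Finset.mul_sum (s := (Finset.univ : Finset (Fin L → Y))), Finset.sum_div,
          ← Finset.sum_add_distrib]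
        refine Finset.sum_congr rfl fun v _ => Finset.sum_congr rfl fun v' _ => ?_
        ring
    _ ≤ _ := by
        rw [swap, one2, mul_one]
        gcongr
        exact sum_softBad_indep_le hw0 hw1 hk hβ hbad η A

end Core

/-! ### From sets of bad copies to the number of bad copies -/

section Core

variable {Y : Type*} {L Q : ℕ}

lemma sum_softmax (η : ℝ) (bad : List Bool → Y → Prop) (a : Fin Q → Bool) (v : Fin L → Y)
    (i : Fin Q) : ∑ j, softmax η bad a v j = 1 := by
  simp only [softmax, ← Finset.sum_div]
  exact div_self (Finset.sum_pos (fun _ _ => Real.exp_pos _) ⟨i, Finset.mem_univ _⟩).ne'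

lemma softmax_le_exp (η : ℝ) (bad : List Bool → Y → Prop) (a : Fin Q → Bool) (v : Fin L → Y)
    (i j : Fin Q) : softmax η bad a v i ≤
      Real.exp (η * count (bad (answerPrefix a i)) v - η * count (bad (answerPrefix a j)) v) := by
  rw [softmax, Real.exp_sub]
  gcongr
  exact Finset.single_le_sum (f := fun j : Fin Q =>
    Real.exp (η * count (bad (answerPrefix a j)) v)) (fun _ _ => (Real.exp_pos _).le)
    (Finset.mem_univ j)

lemma sum_powersetCard_softBad (η : ℝ) (bad : List Bool → Y → Prop) (a : Fin Q → Bool)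
    (v : Fin L → Y) (m : ℕ) :
    ∑ A ∈ Finset.powersetCard m (Finset.univ : Finset (Fin L)), softBad η bad A a v v =
      ∑ i, softmax η bad a v i * (count (bad (answerPrefix a i)) v).choose m := by
  classical
  simp only [softBad]
  rw [Finset.sum_comm]
  refine Finset.sum_congr rfl fun i _ => ?_
  rw [← Finset.mul_sum, ← card_powersetCard_filter_forall, Finset.sum_boole]

/-- The right side is the descending factorial, whose `m` factors are all at least `n + 1 - m`. -/
lemma pow_le_factorial_mul_choose {n m : ℕ} {x : ℝ} (hx : 0 ≤ x) (h : x + m ≤ n) :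
    x ^ m ≤ m.factorial * n.choose m := by
  have hmn : m ≤ n := by exact_mod_cast (by linarith : (m : ℝ) ≤ n)
  have h1 : ((n + 1 - m : ℕ) : ℝ) ^ m ≤ m.factorial * n.choose m := by
    have := Nat.pow_sub_le_descFactorial n m
    rw [Nat.descFactorial_eq_factorial_mul_choose] at this
    exact_mod_cast this
  refine le_trans ?_ h1
  gcongr
  rw [Nat.cast_sub (by omega)]
  push_cast
  linarith

/-- A round with fewer than `0.34 * L` bad copies trails round `i` by at least `0.01 * L`. At `η =
0.01` the hypothesis on `L` therefore gives it softmax weight at most `1 / (2 * Q)`. Such rounds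
carry weight at most one half in total, and every other round has a large binomial coefficient
because `0.34 - 0.01 = 0.33`. -/
lemma half_pow_le_sum_softBad {bad : List Bool → Y → Prop} {m : ℕ} (a : Fin Q → Bool)
    (v : Fin L → Y) (i : Fin Q) (hm : (m : ℝ) ≤ 0.01 * L) (hL : 10000 * Real.log (2 * Q) ≤ L)
    (hi : 0.35 * (L : ℝ) ≤ count (bad (answerPrefix a i)) v) :
    (0.33 * (L : ℝ)) ^ m / 2 ≤ m.factorial *
      ∑ A ∈ Finset.powersetCard m (Finset.univ : Finset (Fin L)), softBad 0.01 bad A a v v := by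
  have hQ : (0 : ℝ) < Q := by exact_mod_cast (Nat.zero_le _).trans_lt i.2
  rw [sum_powersetCard_softBad, Finset.mul_sum]
  have key : ∀ j : Fin Q, (softmax 0.01 bad a v j - 1 / (2 * Q)) * (0.33 * (L : ℝ)) ^ m ≤
      m.factorial * (softmax 0.01 bad a v j * (count (bad (answerPrefix a j)) v).choose m) := by
    intro j
    have h0 := softmax_nonneg 0.01 bad a v j
    rcases le_or_gt (0.34 * (L : ℝ)) (count (bad (answerPrefix a j)) v) with hj | hj
    · have h1 : (0.33 * (L : ℝ)) ^ m ≤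
          m.factorial * (count (bad (answerPrefix a j)) v).choose m :=
        pow_le_factorial_mul_choose (by positivity) (by linarith)
      calc _ ≤ softmax 0.01 bad a v j * (0.33 * (L : ℝ)) ^ m := by
            gcongr
            linarith [show (0 : ℝ) ≤ 1 / (2 * Q) by positivity]
        _ ≤ softmax 0.01 bad a v j *
            (m.factorial * (count (bad (answerPrefix a j)) v).choose m) := by gcongr
        _ = _ := by ring
    · have h1 : softmax 0.01 bad a v j ≤ 1 / (2 * Q) := by
        refine (softmax_le_exp 0.01 bad a v j i).trans ?_
        rw [← Real.exp_log (show (0 : ℝ) < 1 / (2 * Q) by positivity), one_div, Real.log_inv]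
        gcongr
        linarith
      exact (mul_nonpos_of_nonpos_of_nonneg (by linarith) (by positivity)).trans (by positivity)
  refine le_trans ?_ (Finset.sum_le_sum fun j _ => key j)
  rw [← Finset.sum_mul, Finset.sum_sub_distrib, sum_softmax 0.01 bad a v i]
  simp only [Finset.sum_const, Finset.card_univ, Fintype.card_fin, nsmul_eq_mul]
  have : (Q : ℝ) * (1 / (2 * Q)) = 1 / 2 := by field_simp
  rw [this]
  exact le_of_eq (by ring)

variable [Fintype Y] {w : Y → ℝ} {bad : List Bool → Y → Prop}
  {ker : Bool → ℝ → ℝ} {κ : ℝ} {X : List Bool → Y → Bool}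

open Classical in
/-- Adaptive generalization: it is unlikely that in some round at least `35%` of the copies are
bad, although the rounds are chosen depending on the answers. -/
theorem sum_exists_bad_le (hκ : 0 ≤ κ) (hw0 : ∀ y, 0 ≤ w y) (hw1 : ∑ y, w y = 1)
    (hk : IsLogLipschitz ker κ)
    (hbad : ∀ (a : Fin Q → Bool) (i : Fin Q),
      ∑ y, (if bad (answerPrefix a i) y then w y else 0) ≤ 0.1)
    (hL0 : 0 < L) {m : ℕ} (hm : (m : ℝ) ≤ 0.01 * L) (hL : 10000 * Real.log (2 * Q) ≤ L) :
    ∑ v : Fin L → Y, prodWeight w v * ∑ a : Fin Q → Bool,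
        (if ∃ i : Fin Q, 0.35 * (L : ℝ) ≤ count (bad (answerPrefix a i)) v then
          pathWeight (voteWeight ker X v) a else 0) ≤
      2 * (0.32 / 0.33) ^ m * Real.exp (3 * (κ * (m / L)) ^ 2) ^ Q := by
  set E := Real.exp (3 * (κ * (m / L)) ^ 2) ^ Q with hE
  have hE1 : 1 ≤ E := one_le_pow₀ (Real.one_le_exp (by positivity))
  have hLp : (0 : ℝ) < L := by exact_mod_cast hL0
  set P := ∑ v : Fin L → Y, prodWeight w v * ∑ a : Fin Q → Bool,
        (if ∃ i : Fin Q, 0.35 * (L : ℝ) ≤ count (bad (answerPrefix a i)) v then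
          pathWeight (voteWeight ker X v) a else 0)
  have hA : ∀ A ∈ Finset.powersetCard m (Finset.univ : Finset (Fin L)),
      ∑ v : Fin L → Y, prodWeight w v *
        ∑ a : Fin Q → Bool, pathWeight (voteWeight ker X v) a * softBad 0.01 bad A a v v ≤
      0.32 ^ m * E := by
    intro A hA
    have hc : A.card = m := (Finset.mem_powersetCard.1 hA).2
    -- The choice `θ = 0.32 ^ m` balances the two terms: `0.1 * 1.024 = 0.32 ^ 2`, where `1.024`
    -- bounds the softmax loss `exp 0.02` per coordinate.
    refine (sum_softBad_le hκ hw0 hw1 hk (by norm_num) hbad (by norm_num)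
      (show (0 : ℝ) < 0.32 ^ m by positivity) A).trans ?_
    rw [hc, ← hE]
    have h1 : Real.exp (2 * 0.01 * m) ≤ 1.024 ^ m := by
      rw [mul_comm, Real.exp_nat_mul]
      gcongr
      have := Real.exp_bound_div_one_sub_of_interval (x := 2 * 0.01) (by norm_num) (by norm_num)
      exact this.trans (by norm_num)
    have h2 : ((0.32 : ℝ) ^ m)⁻¹ * (Real.exp (2 * 0.01 * m) * 0.1 ^ m) ≤ 0.32 ^ m := by
      calc _ ≤ ((0.32 : ℝ) ^ m)⁻¹ * (1.024 ^ m * 0.1 ^ m) := by gcongr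
        _ = 0.32 ^ m := by
          rw [← inv_pow, ← mul_pow, ← mul_pow]
          norm_num
    have h3 : (0.32 : ℝ) ^ m * 1 ≤ 0.32 ^ m * E := by gcongr
    linarith
  -- Markov's inequality for the softmax average of the binomial moment, whose mean is at most
  -- `choose L m * 0.32 ^ m * E`.
  have main : (0.33 * (L : ℝ)) ^ m / 2 * P ≤ (L : ℝ) ^ m * (0.32 ^ m * E) := by
    calc (0.33 * (L : ℝ)) ^ m / 2 * P
        = ∑ v : Fin L → Y, prodWeight w v * ∑ a : Fin Q → Bool, (0.33 * (L : ℝ)) ^ m / 2 *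
          (if ∃ i : Fin Q, 0.35 * (L : ℝ) ≤ count (bad (answerPrefix a i)) v then
          pathWeight (voteWeight ker X v) a else 0) := by
          simp only [P, Finset.mul_sum]
          exact Finset.sum_congr rfl fun v _ => Finset.sum_congr rfl fun a _ => by ring
      _ ≤ ∑ v : Fin L → Y, prodWeight w v * ∑ a : Fin Q → Bool,
          pathWeight (voteWeight ker X v) a * (m.factorial *
            ∑ A ∈ Finset.powersetCard m (Finset.univ : Finset (Fin L)),
              softBad 0.01 bad A a v v) := by
          refine Finset.sum_le_sum fun v _ => mul_le_mul_of_nonneg_left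
            (Finset.sum_le_sum fun a _ => ?_) (prodWeight_nonneg hw0 v)
          · have hp := pathWeight_nonneg (voteWeight_nonneg (X := X) hk v) a
            split_ifs with h
            · obtain ⟨i, hi⟩ := h
              rw [mul_comm]
              exact mul_le_mul_of_nonneg_left (half_pow_le_sum_softBad a v i hm hL hi) hp
            · rw [mul_zero]
              exact mul_nonneg hp (mul_nonneg (by positivity)
                (Finset.sum_nonneg fun A _ => softBad_nonneg _ _ _ _ _ _))
      _ = m.factorial * ∑ A ∈ Finset.powersetCard m (Finset.univ : Finset (Fin L)),
          ∑ v : Fin L → Y, prodWeight w v * ∑ a : Fin Q → Bool,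
            pathWeight (voteWeight ker X v) a * softBad 0.01 bad A a v v := by
          rw [Finset.sum_comm, Finset.mul_sum]
          refine Finset.sum_congr rfl fun v _ => ?_
          rw [← Finset.mul_sum, Finset.sum_comm, mul_left_comm,
            Finset.mul_sum (a := (m.factorial : ℝ))]
          congr 1
          refine Finset.sum_congr rfl fun a _ => ?_
          rw [← Finset.mul_sum]
          ring
      _ ≤ m.factorial * ∑ A ∈ Finset.powersetCard m (Finset.univ : Finset (Fin L)),
          0.32 ^ m * E := by
          gcongr with A hA'
          exact hA A hA'
      _ = (m.factorial * (L.choose m : ℝ)) * (0.32 ^ m * E) := by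
          simp only [Finset.sum_const, Finset.card_powersetCard, Finset.card_univ,
            Fintype.card_fin, nsmul_eq_mul]
          ring
      _ ≤ (L : ℝ) ^ m * (0.32 ^ m * E) := by
          gcongr
          have := Nat.descFactorial_le_pow L m
          rw [Nat.descFactorial_eq_factorial_mul_choose] at this
          exact_mod_cast this
  have e : (L : ℝ) ^ m * (0.32 ^ m * E) =
      (0.33 * (L : ℝ)) ^ m / 2 * (2 * (0.32 / 0.33) ^ m * E) := by
    rw [mul_pow, div_pow]
    field_simp
  rw [e] at main
  exact le_of_mul_le_mul_left main (by positivity)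

end Core

/-! ### Mixtures over independent uniform samples -/

/-- The mean of `F (N + B)`, where `B` is binomial with parameters `k` and `p`. -/
noncomputable def binomialMean (p : ℝ) : ℕ → (ℕ → ℝ) → ℕ → ℝ
  | 0, F => F
  | k + 1, F => fun N => (1 - p) * binomialMean p k F N + p * binomialMean p k F (N + 1)

section Binomial

variable {p p' : ℝ}

lemma binomialMean_mono (hp : p ∈ Set.Icc (0 : ℝ) 1) {F G : ℕ → ℝ} (h : ∀ N, F N ≤ G N) (k : ℕ) :
    ∀ N, binomialMean p k F N ≤ binomialMean p k G N := by
  induction k with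
  | zero => exact h
  | succ k ih =>
    intro N
    have h1 := hp.1
    have h2 := sub_nonneg.2 hp.2
    simp only [binomialMean]
    gcongr <;> exact ih _

lemma binomialMean_const_mul (c : ℝ) (F : ℕ → ℝ) (k : ℕ) :
    ∀ N, binomialMean p k (fun N => c * F N) N = c * binomialMean p k F N := by
  induction k with
  | zero => intro N; rfl
  | succ k ih => intro N; simp only [binomialMean, ih]; ring

lemma binomialMean_add (F G : ℕ → ℝ) (k : ℕ) :
    ∀ N, binomialMean p k (fun N => F N + G N) N =
      binomialMean p k F N + binomialMean p k G N := by
  induction k with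
  | zero => intro N; rfl
  | succ k ih => intro N; simp only [binomialMean, ih]; ring

lemma binomialMean_shift (F : ℕ → ℝ) (k : ℕ) :
    ∀ N, binomialMean p k F (N + 1) = binomialMean p k (fun N => F (N + 1)) N := by
  induction k with
  | zero => intro N; rfl
  | succ k ih => intro N; simp only [binomialMean, ih]

lemma binomialMean_const (c : ℝ) (k : ℕ) : ∀ N, binomialMean p k (fun _ => c) N = c := by
  induction k with
  | zero => intro N; rfl
  | succ k ih => intro N; simp only [binomialMean, ih]; ring

lemma binomialMean_nonneg (hp : p ∈ Set.Icc (0 : ℝ) 1) {F : ℕ → ℝ} (h : ∀ N, 0 ≤ F N) (k N : ℕ) :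
    0 ≤ binomialMean p k F N := by
  have := binomialMean_mono hp h k N
  rwa [binomialMean_const] at this

lemma binomialMean_geometric (x : ℝ) (k : ℕ) :
    ∀ N, binomialMean p k (fun N => x ^ N) N = x ^ N * (1 - p + p * x) ^ k := by
  induction k with
  | zero => intro N; simp [binomialMean]
  | succ k ih => intro N; simp only [binomialMean, ih]; ring

/-- The success probability is changed one sample at a time. If one more vote changes the mean by a
factor between `1 / e` and `e`, then `|y - x| ≤ 2 * min x y`, because `e ≤ 3`. Each sample then
costs a factor `1 + 2 * |p - p'|`. -/
lemma binomialMean_le_exp_mul (hp : p ∈ Set.Icc (0 : ℝ) 1) (hp' : p' ∈ Set.Icc (0 : ℝ) 1)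
    {F : ℕ → ℝ} (h0 : ∀ N, 0 ≤ F N) (h1 : ∀ N, F (N + 1) ≤ Real.exp 1 * F N)
    (h2 : ∀ N, F N ≤ Real.exp 1 * F (N + 1)) (k : ℕ) :
    ∀ N, binomialMean p k F N ≤ Real.exp (2 * k * |p - p'|) * binomialMean p' k F N := by
  induction k with
  | zero => intro N; simp [binomialMean]
  | succ k ih =>
    intro N
    set x := binomialMean p' k F N with hx
    set y := binomialMean p' k F (N + 1) with hy
    have hx0 : 0 ≤ x := binomialMean_nonneg hp' h0 k N
    have hy0 : 0 ≤ y := binomialMean_nonneg hp' h0 k (N + 1)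
    have hyx : y ≤ Real.exp 1 * x := by
      rw [hy, hx, binomialMean_shift, ← binomialMean_const_mul]
      exact binomialMean_mono hp' h1 k N
    have hxy : x ≤ Real.exp 1 * y := by
      rw [hy, hx, binomialMean_shift, ← binomialMean_const_mul]
      exact binomialMean_mono hp' h2 k N
    have he : Real.exp 1 ≤ 3 := by linarith [Real.exp_one_lt_d9]
    have hp1 := hp.1
    have hp2 := sub_nonneg.2 hp.2
    have step : (1 - p) * x + p * y ≤ (1 + 2 * |p - p'|) * ((1 - p') * x + p' * y) := by
      have a1 : |y - x| ≤ 2 * x := by rw [abs_le]; constructor <;> nlinarith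
      have a2 : |y - x| ≤ 2 * y := by rw [abs_le]; constructor <;> nlinarith
      have a3 : |y - x| ≤ 2 * ((1 - p') * x + p' * y) := by
        nlinarith [mul_le_mul_of_nonneg_left a1 (sub_nonneg.2 hp'.2),
          mul_le_mul_of_nonneg_left a2 hp'.1]
      have a4 : (p - p') * (y - x) ≤ |p - p'| * |y - x| := by
        rw [← abs_mul]; exact le_abs_self _
      nlinarith [mul_le_mul_of_nonneg_left a3 (abs_nonneg (p - p'))]
    calc binomialMean p (k + 1) F N
        ≤ (1 - p) * (Real.exp (2 * k * |p - p'|) * x) +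
          p * (Real.exp (2 * k * |p - p'|) * y) := by
          simp only [binomialMean]
          gcongr <;> exact ih _
      _ = Real.exp (2 * k * |p - p'|) * ((1 - p) * x + p * y) := by ring
      _ ≤ Real.exp (2 * k * |p - p'|) *
          (Real.exp (2 * |p - p'|) * ((1 - p') * x + p' * y)) := by
          refine mul_le_mul_of_nonneg_left (step.trans ?_) (Real.exp_pos _).le
          refine mul_le_mul_of_nonneg_right ?_ ?_
          · linarith [Real.add_one_le_exp (2 * |p - p'|)]
          · exact add_nonneg (mul_nonneg (sub_nonneg.2 hp'.2) hx0) (mul_nonneg hp'.1 hy0)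
      _ = _ := by
          rw [← mul_assoc, ← Real.exp_add]
          change _ = Real.exp (2 * ((k + 1 : ℕ) : ℝ) * |p - p'|) * ((1 - p') * x + p' * y)
          push_cast
          ring_nf

end Binomial

/-- The average over uniform samples with replacement is a binomial mean. -/
lemma sum_samples_eq_binomialMean {L : ℕ} (hL : 0 < L) (x : Fin L → Prop) [DecidablePred x]
    (F : ℕ → ℝ) (k : ℕ) :
    ∀ N, ∑ j : Fin k → Fin L, ((L : ℝ)⁻¹) ^ k * F (N + ∑ i, if x (j i) then 1 else 0) =
      binomialMean ((Finset.univ.filter x).card / L) k F N := by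
  induction k with
  | zero => intro N; simp [binomialMean]
  | succ k ih =>
    intro N
    have hL' : (L : ℝ) ≠ 0 := by exact_mod_cast hL.ne'
    rw [← (Fin.consEquiv fun _ => Fin L).sum_comp, Fintype.sum_prod_type]
    simp only [Fin.consEquiv, Equiv.coe_fn_mk, Fin.sum_univ_succ, Fin.cons_zero, Fin.cons_succ,
      binomialMean, ← ih]
    have e : ∀ l : Fin L, ∑ j : Fin k → Fin L, ((L : ℝ)⁻¹) ^ (k + 1) *
        F (N + ((if x l then 1 else 0) + ∑ i, if x (j i) then 1 else 0)) =
        (L : ℝ)⁻¹ * (if x l then ∑ j : Fin k → Fin L, ((L : ℝ)⁻¹) ^ k *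
          F (N + 1 + ∑ i, if x (j i) then 1 else 0) else ∑ j : Fin k → Fin L, ((L : ℝ)⁻¹) ^ k *
          F (N + ∑ i, if x (j i) then 1 else 0)) := by
      intro l
      split_ifs <;> simp only [Finset.mul_sum, pow_succ, add_assoc, zero_add] <;>
        exact Finset.sum_congr rfl fun j _ => by ring
    simp only [e]
    rw [← Finset.mul_sum, Finset.sum_ite]
    simp only [Finset.sum_const, nsmul_eq_mul]
    have hc : ((Finset.univ.filter fun l => ¬ x l).card : ℝ) =
        L - (Finset.univ.filter x).card := by
      have := Finset.card_filter_add_card_filter_not (s := (Finset.univ : Finset (Fin L))) x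
      rw [Finset.card_univ, Fintype.card_fin] at this
      rw [eq_sub_iff_add_eq']
      exact_mod_cast this
    rw [hc]
    field_simp
    ring

/-! ### The Laplace distribution -/

section Laplace

variable {b : ℝ}

lemma laplace_Ioi (hb : 0 < b) {t : ℝ} (ht : 0 ≤ t) :
    laplace b (Set.Ioi t) = ENNReal.ofReal (Real.exp (-t / b) / 2) := by
  have ha : -b⁻¹ < 0 := by simpa using hb
  have h1 := (integrableOn_exp_mul_Ioi ha t).const_mul (1 / (2 * b))
  rw [laplace, withDensity_apply _ measurableSet_Ioi,
    setLIntegral_congr_fun (g := fun x => ENNReal.ofReal (1 / (2 * b) * Real.exp (-b⁻¹ * x)))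
      measurableSet_Ioi (fun x (hx : t < x) => ?_),
    ← ofReal_integral_eq_lintegral_ofReal h1 (.of_forall fun x => by positivity),
    integral_const_mul, integral_exp_mul_Ioi ha]
  · congr 1
    rw [show -b⁻¹ * t = -t / b by ring]
    field_simp
  · simp only [abs_of_pos (ht.trans_lt hx)]
    rw [show -x / b = -b⁻¹ * x by ring]

lemma laplace_Iic (hb : 0 < b) {t : ℝ} (ht : t ≤ 0) :
    laplace b (Set.Iic t) = ENNReal.ofReal (Real.exp (t / b) / 2) := by
  have ha : 0 < b⁻¹ := by simpa using hb
  have h1 := (integrableOn_exp_mul_Iic ha t).const_mul (1 / (2 * b))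
  rw [laplace, withDensity_apply _ measurableSet_Iic,
    setLIntegral_congr_fun (g := fun x => ENNReal.ofReal (1 / (2 * b) * Real.exp (b⁻¹ * x)))
      measurableSet_Iic (fun x (hx : x ≤ t) => ?_),
    ← ofReal_integral_eq_lintegral_ofReal h1 (.of_forall fun x => by positivity),
    integral_const_mul, integral_exp_mul_Iic ha]
  · congr 1
    rw [show b⁻¹ * t = t / b by ring]
    field_simp
  · simp only [abs_of_nonpos (hx.trans ht), neg_neg]
    rw [show x / b = b⁻¹ * x by ring]

lemma isProbabilityMeasure_laplace (hb : 0 < b) : IsProbabilityMeasure (laplace b) := by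
  constructor
  rw [← Set.Iic_union_Ioi (a := (0 : ℝ)), measure_union (Set.Iic_disjoint_Ioi le_rfl)
    measurableSet_Ioi, laplace_Ioi hb le_rfl, laplace_Iic hb le_rfl,
    ← ENNReal.ofReal_add (by positivity) (by positivity)]
  norm_num

/-- The halved exponent makes `1 / 2` the Chernoff parameter for the votes. The bound holds for
every real `t`, so it applies to every vote count. -/
lemma laplace_Ioi_le (hb : 0 < b) (t : ℝ) :
    laplace b (Set.Ioi t) ≤ ENNReal.ofReal (Real.exp (-t / b / 2)) := by
  have := isProbabilityMeasure_laplace hb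
  rcases le_total 0 t with ht | ht
  · rw [laplace_Ioi hb ht]
    apply ENNReal.ofReal_le_ofReal
    have : Real.exp (-t / b) ≤ Real.exp (-t / b / 2) := by
      apply Real.exp_le_exp.2
      have : 0 ≤ t / b := by positivity
      rw [neg_div]
      linarith
    linarith [Real.exp_pos (-t / b)]
  · refine prob_le_one.trans ?_
    rw [ENNReal.one_le_ofReal]
    exact Real.one_le_exp (by have := neg_nonneg.2 ht; positivity)

lemma laplace_Iic_le (hb : 0 < b) (t : ℝ) :
    laplace b (Set.Iic t) ≤ ENNReal.ofReal (Real.exp (t / b / 2)) := by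
  have := isProbabilityMeasure_laplace hb
  rcases le_total t 0 with ht | ht
  · rw [laplace_Iic hb ht]
    apply ENNReal.ofReal_le_ofReal
    have : Real.exp (t / b) ≤ Real.exp (t / b / 2) := by
      apply Real.exp_le_exp.2
      have : t / b ≤ 0 := div_nonpos_of_nonpos_of_nonneg ht hb.le
      linarith
    linarith [Real.exp_pos (t / b)]
  · refine prob_le_one.trans ?_
    rw [ENNReal.one_le_ofReal]
    exact Real.one_le_exp (by positivity)

/-- Translation by `c` changes the density by a factor of at most `exp (|c| / b)`, by the triangle
inequality in the exponent. This is the privacy of Laplace noise. -/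
lemma laplace_preimage_add_le (hb : 0 < b) (c : ℝ) {E : Set ℝ} (hE : MeasurableSet E) :
    laplace b ((· + c) ⁻¹' E) ≤ ENNReal.ofReal (Real.exp (|c| / b)) * laplace b E := by
  have hE' : MeasurableSet ((· + c) ⁻¹' E) := measurable_add_const c hE
  rw [laplace, withDensity_apply _ hE, withDensity_apply _ hE', ← lintegral_indicator hE,
    ← lintegral_indicator hE', ← lintegral_const_mul' _ _ ENNReal.ofReal_ne_top,
    ← lintegral_add_right_eq_self (μ := volume) (fun x => ENNReal.ofReal (Real.exp (|c| / b)) *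
      E.indicator (fun x => ENNReal.ofReal (1 / (2 * b) * Real.exp (-|x| / b))) x) c]
  refine lintegral_mono fun x => ?_
  by_cases hx : x + c ∈ E
  · have hx' : x ∈ (· + c) ⁻¹' E := hx
    rw [Set.indicator_of_mem hx, Set.indicator_of_mem hx', ← ENNReal.ofReal_mul (by positivity)]
    apply ENNReal.ofReal_le_ofReal
    rw [mul_left_comm, ← Real.exp_add]
    gcongr
    rw [← add_div]
    gcongr
    linarith [abs_add_le x c]
  · have hx' : x ∉ (· + c) ⁻¹' E := hx
    rw [Set.indicator_of_notMem hx']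
    exact zero_le

end Laplace

/-! ### The law of one answer -/

/-- The probability of the answer `b` when `N` of the `k` sampled copies answer `1`. -/
noncomputable def thresholdProb (k : ℕ) (b : Bool) (N : ℕ) : ℝ :=
  (laplace (1 / (k : ℝ))).real {z | decide ((1 / 2 : ℝ) < (N : ℝ) / (k : ℝ) + z) = b}

/-- The probability of the answer `b` when a fraction `p` of the copies answers `1`. -/
noncomputable def answerProb (k : ℕ) (b : Bool) (p : ℝ) : ℝ :=
  binomialMean p k (thresholdProb k b) 0

section Threshold

variable {k : ℕ}

lemma setOf_threshold_true (N : ℕ) :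
    {z : ℝ | decide ((1 / 2 : ℝ) < (N : ℝ) / (k : ℝ) + z) = true} =
      Set.Ioi (1 / 2 - (N : ℝ) / k) := by
  ext z; simp only [decide_eq_true_eq, Set.mem_ofPred_eq, Set.mem_Ioi, sub_lt_iff_lt_add']

lemma setOf_threshold_false (N : ℕ) :
    {z : ℝ | decide ((1 / 2 : ℝ) < (N : ℝ) / (k : ℝ) + z) = false} =
      Set.Iic (1 / 2 - (N : ℝ) / k) := by
  ext z; simp only [decide_eq_false_iff_not, not_lt, Set.mem_ofPred_eq, Set.mem_Iic,
    le_sub_iff_add_le']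

lemma measurableSet_threshold (b : Bool) (N : ℕ) :
    MeasurableSet {z : ℝ | decide ((1 / 2 : ℝ) < (N : ℝ) / (k : ℝ) + z) = b} := by
  cases b
  · rw [setOf_threshold_false]; exact measurableSet_Iic
  · rw [setOf_threshold_true]; exact measurableSet_Ioi

lemma thresholdProb_nonneg (b : Bool) (N : ℕ) : 0 ≤ thresholdProb k b N :=
  measureReal_nonneg

lemma thresholdProb_add (hk : 0 < k) (N : ℕ) :
    thresholdProb k true N + thresholdProb k false N = 1 := by
  have := isProbabilityMeasure_laplace (b := 1 / (k : ℝ)) (by positivity)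
  simp only [thresholdProb, setOf_threshold_true, setOf_threshold_false]
  rw [← Set.compl_Ioi]
  exact probReal_add_probReal_compl measurableSet_Ioi

lemma thresholdProb_true_le (hk : 0 < k) (N : ℕ) :
    thresholdProb k true N ≤ Real.exp (-k / 4) * Real.exp (1 / 2) ^ N := by
  have hk' : (0 : ℝ) < k := by exact_mod_cast hk
  rw [thresholdProb, setOf_threshold_true, measureReal_def]
  refine ENNReal.toReal_le_of_le_ofReal (by positivity)
    ((laplace_Ioi_le (by positivity) _).trans (ENNReal.ofReal_le_ofReal (le_of_eq ?_)))
  rw [← Real.exp_nat_mul, ← Real.exp_add]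
  congr 1
  field_simp
  ring

lemma thresholdProb_false_le (hk : 0 < k) (N : ℕ) :
    thresholdProb k false N ≤ Real.exp (k / 4) * Real.exp (-(1 / 2)) ^ N := by
  have hk' : (0 : ℝ) < k := by exact_mod_cast hk
  rw [thresholdProb, setOf_threshold_false, measureReal_def]
  refine ENNReal.toReal_le_of_le_ofReal (by positivity)
    ((laplace_Iic_le (by positivity) _).trans (ENNReal.ofReal_le_ofReal (le_of_eq ?_)))
  rw [← Real.exp_nat_mul, ← Real.exp_add]
  congr 1
  field_simp
  ring

/-- One vote moves the empirical fraction by `1 / k`, exactly the scale of the noise. -/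
lemma thresholdProb_shift (hk : 0 < k) (b : Bool) (N N' : ℕ) (h : |(N : ℝ) - N'| ≤ 1) :
    thresholdProb k b N ≤ Real.exp 1 * thresholdProb k b N' := by
  have hk' : (0 : ℝ) < k := by exact_mod_cast hk
  have := isProbabilityMeasure_laplace (b := 1 / (k : ℝ)) (by positivity)
  have hs := laplace_preimage_add_le (b := 1 / (k : ℝ)) (by positivity) (((N : ℝ) - N') / k)
    (measurableSet_threshold (k := k) b N')
  have e : (· + ((N : ℝ) - N') / k) ⁻¹'
      {z : ℝ | decide ((1 / 2 : ℝ) < (N' : ℝ) / (k : ℝ) + z) = b} =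
      {z : ℝ | decide ((1 / 2 : ℝ) < (N : ℝ) / (k : ℝ) + z) = b} := by
    ext z
    simp only [Set.mem_preimage, Set.mem_ofPred_eq]
    rw [show (N' : ℝ) / k + (z + (N - N') / k) = N / k + z by ring]
  rw [e] at hs
  have hx : Real.exp (|((N : ℝ) - N') / k| / (1 / k)) ≤ Real.exp 1 := by
    apply Real.exp_le_exp.2
    rw [abs_div, Nat.abs_cast]
    field_simp
    exact h
  rw [thresholdProb, thresholdProb, measureReal_def, measureReal_def,
    ← ENNReal.toReal_ofReal (Real.exp_pos 1).le, ← ENNReal.toReal_mul]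
  exact ENNReal.toReal_mono (ENNReal.mul_ne_top ENNReal.ofReal_ne_top (measure_ne_top _ _))
    (hs.trans (by gcongr))

lemma isLogLipschitz_answerProb (hk : 0 < k) : IsLogLipschitz (answerProb k) (2 * k) where
  nonneg b p hp := binomialMean_nonneg hp (thresholdProb_nonneg b) k 0
  sum_eq_one p hp := by
    rw [Fintype.sum_bool, answerProb, answerProb, ← binomialMean_add]
    simp only [thresholdProb_add hk, binomialMean_const]
  le_exp_mul b p hp p' hp' := by
    refine binomialMean_le_exp_mul hp hp' (thresholdProb_nonneg b) (fun N => ?_) (fun N => ?_) k 0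
    · exact thresholdProb_shift hk b _ _ (by simp)
    · exact thresholdProb_shift hk b _ _ (by simp)

lemma one_add_mul_exp_half_le {p : ℝ} (hp : p ≤ 0.35) :
    1 + p * (Real.exp (1 / 2) - 1) ≤ Real.exp (9 / 40) := by
  have h1 : Real.exp (1 / 2) ≤ 1.65 := by
    have h : Real.exp (1 / 2) ^ 2 = Real.exp 1 := by rw [← Real.exp_nat_mul]; norm_num
    nlinarith [Real.exp_one_lt_d9, Real.exp_pos (1 / 2)]
  have h2 := Real.quadratic_le_exp_of_nonneg (x := 9 / 40) (by norm_num)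
  have h3 : 1 ≤ Real.exp (1 / 2) := Real.one_le_exp (by norm_num)
  nlinarith

/-- Noise and votes are treated by one exponential moment: the tail bound is geometric in the vote
count, so its binomial mean is a moment generating function. The rate is `1 / 4 - 9 / 40 = 1 / 40`.
-/
lemma answerProb_true_le (hk : 0 < k) {p : ℝ} (hp : p ∈ Set.Icc (0 : ℝ) 1) (h : p ≤ 0.35) :
    answerProb k true p ≤ Real.exp (-k / 40) := by
  refine (binomialMean_mono hp (thresholdProb_true_le hk) k 0).trans ?_
  rw [binomialMean_const_mul, binomialMean_geometric, pow_zero, one_mul]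
  calc _ ≤ Real.exp (-k / 4) * Real.exp (9 / 40) ^ k := by
        have h0 : 0 ≤ 1 - p + p * Real.exp (1 / 2) :=
          add_nonneg (sub_nonneg.2 hp.2) (mul_nonneg hp.1 (Real.exp_pos _).le)
        gcongr
        linarith [one_add_mul_exp_half_le h]
    _ = _ := by
        rw [← Real.exp_nat_mul, ← Real.exp_add]
        ring_nf

lemma answerProb_false_le (hk : 0 < k) {p : ℝ} (hp : p ∈ Set.Icc (0 : ℝ) 1) (h : 0.65 ≤ p) :
    answerProb k false p ≤ Real.exp (-k / 40) := by
  refine (binomialMean_mono hp (thresholdProb_false_le hk) k 0).trans ?_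
  rw [binomialMean_const_mul, binomialMean_geometric, pow_zero, one_mul]
  have e : Real.exp (1 / 2) * Real.exp (-(1 / 2)) = 1 := by rw [← Real.exp_add]; simp
  -- Factoring out `exp (-1 / 2)` turns votes for `1` into votes for `0`, so the numerical bound for
  -- the other case applies with `1 - p`.
  calc Real.exp (k / 4) * (1 - p + p * Real.exp (-(1 / 2))) ^ k
      = Real.exp (k / 4) * (Real.exp (-(1 / 2)) *
          (1 + (1 - p) * (Real.exp (1 / 2) - 1))) ^ k := by
        congr 2
        linear_combination (-(1 - p)) * e
    _ ≤ Real.exp (k / 4) * (Real.exp (-(1 / 2)) * Real.exp (9 / 40)) ^ k := by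
        have h0 : 0 ≤ (1 - p) * (Real.exp (1 / 2) - 1) :=
          mul_nonneg (sub_nonneg.2 hp.2) (sub_nonneg.2 (Real.one_le_exp (by norm_num)))
        gcongr
        exact one_add_mul_exp_half_le (by linarith)
    _ = _ := by
        rw [← Real.exp_add, ← Real.exp_nat_mul, ← Real.exp_add]
        ring_nf

end Threshold

/-- The law of one answer of the robust decider, given the answers of the copies. -/
lemma coinLaw_answer_le {L k : ℕ} (hL : 0 < L) (hk : 0 < k) (x : Fin L → Bool) (b : Bool) :
    ((Measure.pi fun _ : Fin k => ProbabilityTheory.uniformOn (Set.univ : Set (Fin L))).prod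
      (laplace (1 / (k : ℝ)))) {ρ | decide ((1 / 2 : ℝ) <
        ((∑ i, if x (ρ.1 i) = true then 1 else 0 : ℕ) : ℝ) / (k : ℝ) + ρ.2) = b} ≤
      ENNReal.ofReal (answerProb k b (count (fun y : Bool => y = true) x / L)) := by
  have := isProbabilityMeasure_laplace (b := 1 / (k : ℝ)) (by positivity)
  have : Nonempty (Fin L) := ⟨⟨0, hL⟩⟩
  have : IsProbabilityMeasure (ProbabilityTheory.uniformOn (Set.univ : Set (Fin L))) :=
    ProbabilityTheory.isProbabilityMeasure_uniformOn Set.finite_univ Set.univ_nonempty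
  have e := sum_samples_eq_binomialMean hL (fun l => x l = true) (thresholdProb k b) k 0
  -- Only an upper bound is needed, so a cover by finitely many boxes, one per sample vector,
  -- suffices.
  have hsub : {ρ : (Fin k → Fin L) × ℝ | decide ((1 / 2 : ℝ) <
        ((∑ i, if x (ρ.1 i) = true then 1 else 0 : ℕ) : ℝ) / (k : ℝ) + ρ.2) = b} ⊆
      ⋃ j : Fin k → Fin L, {j} ×ˢ {z | decide ((1 / 2 : ℝ) <
        ((∑ i, if x (j i) = true then 1 else 0 : ℕ) : ℝ) / (k : ℝ) + z) = b} := by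
    intro ρ hρ
    exact Set.mem_iUnion.2 ⟨ρ.1, rfl, hρ⟩
  refine (measure_mono hsub).trans ((measure_iUnion_fintype_le _ _).trans ?_)
  have hc : (count (fun y : Bool => y = true) x / L : ℝ) =
      (Finset.univ.filter fun l => x l = true).card / L := by
    rw [count]; congr!
  rw [hc, answerProb, ← e, ENNReal.ofReal_sum_of_nonneg fun j _ =>
    mul_nonneg (by positivity) (thresholdProb_nonneg _ _)]
  refine Finset.sum_le_sum fun j _ => ?_
  rw [Measure.prod_prod, Measure.pi_singleton, zero_add, ENNReal.ofReal_mul (by positivity),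
    thresholdProb, ofReal_measureReal]
  gcongr
  simp only [ProbabilityTheory.uniformOn_univ, Measure.count_singleton, Fintype.card_fin,
    Finset.prod_const, Finset.card_univ]
  rw [ENNReal.ofReal_pow (by positivity), ENNReal.ofReal_inv_of_pos (by exact_mod_cast hL),
    ENNReal.ofReal_natCast, one_div]

universe uM uG uC uS uR

/-! ### Answers and running time of the robust decider -/

namespace Program

variable {Cell : Type uC} {Cell' : Type uR} {Γ : Type uG}

lemma eval_call (addr : Cell → Cell') (next : Bool → Program Cell' Γ) (mem : Cell' → Γ)
    (p : Program Cell Γ) :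
    (p.call addr next).eval mem = (next (p.eval fun x => mem (addr x))).eval mem := by
  induction p with
  | output b => rfl
  | step p ih => simpa [call, eval] using ih
  | read c p ih => simpa [call, eval] using ih _

/-- A `read` becomes two nodes and every other node becomes one, hence the factor two. -/
lemma time_call_le (addr : Cell → Cell') (next : Bool → Program Cell' Γ) (mem : Cell' → Γ)
    (p : Program Cell Γ) :
    (p.call addr next).time mem ≤
      2 * p.time (fun x => mem (addr x)) + (next (p.eval fun x => mem (addr x))).time mem := by
  induction p with
  | output b => simp only [call, time, eval]; omega
  | step p ih => simp only [call, time, eval]; omega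
  | read c p ih =>
    have := ih (mem (addr c))
    simp only [call, time, eval]
    omega

lemma one_le_time (mem : Cell → Γ) (p : Program Cell Γ) : 1 ≤ p.time mem := by
  cases p <;> simp [time]

end Program

lemma eval_tally {L : ℕ} {Cell : Type uC} {Γ : Type uG} (p : Program Cell Γ)
    (finish : ℕ → Program (Fin L × Cell) Γ) (mem : Fin L × Cell → Γ) (js : List (Fin L)) :
    ∀ N, (tally p finish js N).eval mem = (finish (N + (js.map fun j =>
      if p.eval (fun x => mem (j, x)) = true then 1 else 0).sum)).eval mem := by
  induction js with
  | nil => intro N; simp [tally]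
  | cons j js ih =>
    intro N
    simp only [tally, Program.eval, Program.eval_call, ih, List.map_cons, List.sum_cons]
    congr 2
    split_ifs <;> omega

lemma time_tally_le {L : ℕ} {Cell : Type uC} {Γ : Type uG} (p : Program Cell Γ)
    (finish : ℕ → Program (Fin L × Cell) Γ) (mem : Fin L × Cell → Γ) {t u : ℕ}
    (ht : ∀ j, p.time (fun x => mem (j, x)) ≤ t) (hu : ∀ N, (finish N).time mem ≤ u)
    (js : List (Fin L)) :
    ∀ N, (tally p finish js N).time mem ≤ js.length * (2 * t + 2) + u := by
  induction js with
  | nil => intro N; simpa [tally] using hu N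
  | cons j js ih =>
    intro N
    have h1 := Program.time_call_le (fun x => (j, x)) (fun b =>
      .step (tally p finish js (if b then N + 1 else N))) mem p
    have h2 := ih (if p.eval (fun x => mem (j, x)) then N + 1 else N)
    have h3 := ht j
    simp only [tally, Program.time, List.length_cons] at h1 ⊢
    linarith

section Decider

variable {M : Type uM} {Γ : Type uG} {Cell : ℕ → Type uC} {Seed : Type uS} [MeasurableSpace Seed]

lemma answer_robustDecider (A : DataStructure M Γ Cell Seed Unit) (L k : ℕ) (S : Finset M)
    (σ : Fin L → Seed) (ρ : (Fin k → Fin L) × ℝ) (q : M) :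
    (robustDecider A L k).answer S σ ρ q = decide ((1 / 2 : ℝ) <
      ((∑ i, if A.answer S (σ (ρ.1 i)) () q = true then 1 else 0 : ℕ) : ℝ) / (k : ℝ) + ρ.2) := by
  simp only [DataStructure.answer, robustDecider, eval_tally, Program.eval, List.map_ofFn,
    List.sum_ofFn, zero_add]
  rfl

lemma queryTime_robustDecider_le (A : DataStructure M Γ Cell Seed Unit) (L k : ℕ) {t : ℕ}
    (S : Finset M) (σ : Fin L → Seed) (ρ : (Fin k → Fin L) × ℝ) (q : M)
    (ht : ∀ σ, A.queryTime S σ () q ≤ t) :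
    (robustDecider A L k).queryTime S σ ρ q ≤ k * (2 * t + 2) + 3 := by
  have := time_tally_le (A.query S.card () q)
    (fun N => .step (.step (.output (decide ((1 / 2 : ℝ) < (N : ℝ) / (k : ℝ) + ρ.2)))))
    ((robustDecider A L k).build σ S) (t := t) (u := 3) (fun j => ht (σ j))
    (fun N => le_of_eq rfl) (List.ofFn ρ.1) 0
  rwa [List.length_ofFn] at this

end Decider

/-! ### Transcripts of the game -/

section Game

variable {M : Type uM} {Γ : Type uG} {Cell : ℕ → Type uC} {Seed : Type uS} {Coins : Type uR}
  [MeasurableSpace Seed] [MeasurableSpace Coins]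

/-- The history after the answers `l` of the game against the strategy `B`, started at `h`. -/
def historyFrom (B : List (M × Bool) → M) (h : List (M × Bool)) (l : List Bool) :
    List (M × Bool) :=
  l.foldl (fun h b => h ++ [(B h, b)]) h

lemma exists_play_eq (D : DataStructure M Γ Cell Seed Coins) (S : Finset M)
    (B : List (M × Bool) → M) (σ : Seed) {n : ℕ} :
    ∀ (ρ : Fin n → Coins) (h : List (M × Bool)), ∃ a : Fin n → Bool,
      D.play S B σ (List.ofFn ρ) h = historyFrom B h (List.ofFn a) ∧
      ∀ i, D.answer S σ (ρ i) (B (historyFrom B h (answerPrefix a i))) = a i := by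
  induction n with
  | zero =>
    exact fun ρ h => ⟨Fin.elim0, by simp [DataStructure.play, historyFrom], fun i => i.elim0⟩
  | succ n ih =>
    intro ρ h
    set b := D.answer S σ (ρ 0) (B h) with hb
    obtain ⟨a, ha, ha'⟩ := ih (fun i => ρ i.succ) (h ++ [(B h, b)])
    refine ⟨Fin.cons b a, ?_, fun i => ?_⟩
    · rw [List.ofFn_succ, List.ofFn_succ]
      simpa [DataStructure.play, historyFrom, ← hb] using ha
    · refine Fin.cases ?_ (fun i => ?_) i
      · simp [answerPrefix_zero, historyFrom, hb]
      · simpa [answerPrefix_cons_succ, historyFrom] using ha' i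

lemma mem_historyFrom (B : List (M × Bool) → M) {n : ℕ} :
    ∀ (a : Fin n → Bool) (h : List (M × Bool)) (e : M × Bool),
      e ∈ historyFrom B h (List.ofFn a) →
      e ∈ h ∨ ∃ i : Fin n, e = (B (historyFrom B h (answerPrefix a i)), a i) := by
  induction n with
  | zero => intro a h e he; left; simpa [historyFrom] using he
  | succ n ih =>
    intro a h e he
    obtain ⟨b, a, rfl⟩ : ∃ b a', a = Fin.cons b a' := ⟨a 0, Fin.tail a, (Fin.cons_self_tail a).symm⟩
    rw [List.ofFn_succ] at he
    simp only [Fin.cons_zero, Fin.cons_succ] at he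
    rcases ih a (h ++ [(B h, b)]) e he with h1 | ⟨i, hi⟩
    · rcases List.mem_append.1 h1 with h1 | h1
      · exact Or.inl h1
      · exact Or.inr ⟨0, by simpa [answerPrefix_zero, historyFrom] using h1⟩
    · exact Or.inr ⟨i.succ, by simpa [answerPrefix_cons_succ, historyFrom] using hi⟩

end Game

/-! ### Robustness -/

lemma correctAnswers_nonempty {M : Type uM} [MetricSpace M] {c r : ℝ} (hc : 1 < c) (hr : 0 < r)
    (S : Finset M) (q : M) : (correctAnswers c r S q).Nonempty := by
  by_cases h : (ball S q r).Nonempty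
  · refine ⟨true, fun _ => rfl, fun h' => ?_⟩
    obtain ⟨p, hp, hd⟩ := h
    have : p ∈ ball S q (c * r) := ⟨hp, hd.trans (by nlinarith)⟩
    rw [h'] at this
    exact this.elim
  · exact ⟨false, fun h' => (h h').elim, fun _ => rfl⟩

section Robust

variable {M : Type uM} {Γ : Type uG} {Cell : ℕ → Type uC} {Seed : Type uS} [MeasurableSpace Seed]
  [MetricSpace M]

/-- Nothing is to be shown if both answers are correct. Otherwise exactly one is wrong, the bad
copies are those voting for it, and they make up less than 35% of the votes. Nonemptiness of `good`
excludes the case of two wrong answers. -/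
lemma sum_voteWeight_wrong_le {Y : Type*} {L k : ℕ} (hL : 0 < L) (hk : 0 < k)
    {good : Set Bool} (hgood : good.Nonempty) (X : List Bool → Y → Bool) (v : Fin L → Y)
    (l : List Bool) (h : (count (fun y => X l y ∉ good) v : ℝ) < 0.35 * L) :
    ∑ b, (open Classical in if b ∉ good then voteWeight (answerProb k) X v l b else 0) ≤
      Real.exp (-k / 40) := by
  classical
  have hL' : (0 : ℝ) < L := by exact_mod_cast hL
  have hmem := count_div_mem (fun y => X l y = true) v
  have hsum : count (fun y => X l y = true) v + count (fun y => X l y = false) v = L := by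
    have := Finset.card_filter_add_card_filter_not (s := (Finset.univ : Finset (Fin L)))
      (fun i => X l (v i) = true)
    simp only [Finset.card_univ, Fintype.card_fin, Bool.not_eq_true] at this
    rw [count, count]
    convert this
  rw [Fintype.sum_bool]
  by_cases ht : true ∈ good <;> by_cases hf : false ∈ good
  · simp [ht, hf, Real.exp_nonneg]
  · have e : (fun y => X l y ∉ good) = fun y => X l y = false := by
      funext y; cases hy : X l y <;> simp [ht, hf]
    rw [e] at h
    have hsum' : (count (fun y => X l y = true) v : ℝ) + count (fun y => X l y = false) v = L := by
      exact_mod_cast hsum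
    simp only [ht, hf, not_true_eq_false, not_false_eq_true, if_true, if_false, zero_add]
    refine answerProb_false_le hk hmem ?_
    rw [le_div_iff₀ hL']
    linarith
  · have e : (fun y => X l y ∉ good) = fun y => X l y = true := by
      funext y; cases hy : X l y <;> simp [ht, hf]
    rw [e] at h
    simp only [ht, hf, not_true_eq_false, not_false_eq_true, if_true, if_false, add_zero]
    refine answerProb_true_le hk hmem ?_
    rw [div_le_iff₀ hL']
    exact h.le
  · obtain ⟨b, hb⟩ := hgood
    cases b
    · exact (hf hb).elim
    · exact (ht hb).elim

open Classical in
/-- The probability that some answer is wrong, in terms of the answers of the copies. -/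
lemma sum_wrong_le {Y : Type*} [Fintype Y] {w : Y → ℝ} (hw0 : ∀ y, 0 ≤ w y)
    (hw1 : ∑ y, w y = 1) {Q L k m : ℕ} (hL : 0 < L) (hk : 0 < k)
    (hm : (m : ℝ) ≤ 0.01 * L) (hLQ : 10000 * Real.log (2 * Q) ≤ L) (X : List Bool → Y → Bool)
    {good : List Bool → Set Bool} (hgood : ∀ l, (good l).Nonempty)
    (hbad : ∀ (a : Fin Q → Bool) (i : Fin Q),
      ∑ y, (if X (answerPrefix a i) y ∉ good (answerPrefix a i) then w y else 0) ≤ 0.1) :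
    ∑ v : Fin L → Y, prodWeight w v * ∑ a : Fin Q → Bool,
        (if ∃ i : Fin Q, a i ∉ good (answerPrefix a i) then
          pathWeight (voteWeight (answerProb k) X v) a else 0) ≤
      2 * (0.32 / 0.33) ^ m * Real.exp (3 * (2 * k * (m / L)) ^ 2) ^ Q +
        Q * Real.exp (-k / 40) := by
  have hker := isLogLipschitz_answerProb hk
  set V := voteWeight (L := L) (answerProb k) X
  have hV0 : ∀ v l b, 0 ≤ V v l b := fun v l b => voteWeight_nonneg hker v l b
  obtain ⟨bad, hbad_def⟩ : ∃ bad : List Bool → Y → Prop, bad = fun l y => X l y ∉ good l :=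
    ⟨_, rfl⟩
  -- `E` is the vote error in a round with few bad copies. A wrong answer is either of this kind or
  -- occurs in a round with at least `0.35 * L` bad copies.
  obtain ⟨E, hE_def⟩ : ∃ E : (Fin L → Y) → List Bool → Bool → Prop, ∀ v l b, E v l b ↔
      b ∉ good l ∧ (count (bad l) v : ℝ) < 0.35 * L := ⟨_, fun _ _ _ => Iff.rfl⟩
  have hE : ∀ v, ∑ a : Fin Q → Bool, (if ∃ i : Fin Q, E v (answerPrefix a i) (a i) then
      pathWeight (V v) a else 0) ≤ Q * Real.exp (-k / 40) := by
    intro v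
    refine sum_pathWeight_exists_le Q (V v) (E v) (hV0 v)
      (fun l => (sum_voteWeight hker v l).le) fun l => ?_
    by_cases h : (count (bad l) v : ℝ) < 0.35 * L
    · simp only [hE_def, h, and_true]
      exact sum_voteWeight_wrong_le hL hk (hgood l) X v l (by rwa [hbad_def] at h)
    · simp [hE_def, h, Real.exp_nonneg]
  have hgen := sum_exists_bad_le (κ := 2 * k) (X := X) (bad := bad) (Q := Q) (by positivity)
    hw0 hw1 hker (fun a i => by simpa only [hbad_def] using hbad a i) hL hm hLQ
  calc _ ≤ ∑ v, prodWeight w v * (∑ a : Fin Q → Bool,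
          (if ∃ i : Fin Q, 0.35 * (L : ℝ) ≤ count (bad (answerPrefix a i)) v then
            pathWeight (V v) a else 0) + ∑ a : Fin Q → Bool,
          (if ∃ i : Fin Q, E v (answerPrefix a i) (a i) then pathWeight (V v) a else 0)) := by
        refine Finset.sum_le_sum fun v _ =>
          mul_le_mul_of_nonneg_left ?_ (prodWeight_nonneg hw0 v)
        rw [← Finset.sum_add_distrib]
        refine Finset.sum_le_sum fun a _ => ?_
        have hp := pathWeight_nonneg (hV0 v) a
        by_cases h1 : ∃ i : Fin Q, a i ∉ good (answerPrefix a i)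
        · rw [if_pos h1]
          obtain ⟨i, hi⟩ := h1
          rcases le_or_gt (0.35 * (L : ℝ)) (count (bad (answerPrefix a i)) v) with h2 | h2
          · rw [if_pos (show ∃ i : Fin Q, 0.35 * (L : ℝ) ≤
              count (bad (answerPrefix a i)) v from ⟨i, h2⟩)]
            split_ifs <;> linarith
          · rw [if_pos (show ∃ i : Fin Q, E v (answerPrefix a i) (a i) from
              ⟨i, (hE_def _ _ _).2 ⟨hi, h2⟩⟩)]
            split_ifs <;> linarith
        · rw [if_neg h1]
          split_ifs <;> linarith
    _ ≤ ∑ v, prodWeight w v * (∑ a : Fin Q → Bool,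
          (if ∃ i : Fin Q, 0.35 * (L : ℝ) ≤ count (bad (answerPrefix a i)) v then
            pathWeight (V v) a else 0) + Q * Real.exp (-k / 40)) :=
        Finset.sum_le_sum fun v _ =>
          mul_le_mul_of_nonneg_left (add_le_add_right (hE v) _) (prodWeight_nonneg hw0 v)
    _ ≤ _ := by
        simp only [mul_add, Finset.sum_add_distrib]
        rw [← Finset.sum_mul, sum_prodWeight hw1, one_mul]
        exact add_le_add_left hgen _

/-- Robustness of the decider, for arbitrary numbers of copies and samples. -/
theorem isAdversariallyRobust_robustDecider (A : DataStructure M Γ Cell Seed Unit)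
    [IsProbabilityMeasure A.seedLaw] {c r : ℝ} (hc : 1 < c) (hr : 0 < r)
    (hmeas : ∀ (S : Finset M) (q : M), Measurable fun σ => A.answer S σ () q)
    (hA : A.IsObliviousDecider c r) {Q L k m : ℕ} (hL : 0 < L) (hk : 0 < k)
    (hm : (m : ℝ) ≤ 0.01 * L) (hLQ : 10000 * Real.log (2 * Q) ≤ L) :
    (robustDecider A L k).IsAdversariallyRobust c r Q
      (2 * (0.32 / 0.33) ^ m * Real.exp (3 * (2 * k * (m / L)) ^ 2) ^ Q +
        Q * Real.exp (-k / 40)) := by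
  classical
  intro S B
  have : Nonempty (Fin L) := ⟨⟨0, hL⟩⟩
  have : IsProbabilityMeasure (laplace (1 / (k : ℝ))) :=
    isProbabilityMeasure_laplace (by positivity)
  have : IsProbabilityMeasure (ProbabilityTheory.uniformOn (Set.univ : Set (Fin L))) :=
    ProbabilityTheory.isProbabilityMeasure_uniformOn Set.finite_univ Set.univ_nonempty
  have : IsProbabilityMeasure (robustDecider A L k).coinLaw := by
    simp only [robustDecider]; infer_instance
  have : IsProbabilityMeasure (robustDecider A L k).seedLaw := by
    simp only [robustDecider]; infer_instance
  let qry : List Bool → M := fun l => B (historyFrom B [] l)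
  let good : List Bool → Set Bool := fun l => correctAnswers c r S (qry l)
  -- Only finitely many answer prefixes can occur. Restricting each copy to the corresponding
  -- queries replaces its seed by a finite vector, on which the combinatorial bounds apply.
  let N : Finset (List Bool) := Finset.univ.image
    fun x : (Fin Q → Bool) × Fin Q => answerPrefix x.1 x.2
  have hN : ∀ (a : Fin Q → Bool) (i : Fin Q), answerPrefix a i ∈ N := fun a i =>
    Finset.mem_image.2 ⟨(a, i), Finset.mem_univ _, rfl⟩
  let X : List Bool → (N → Bool) → Bool := fun l y => if h : l ∈ N then y ⟨l, h⟩ else false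
  let f : Seed → N → Bool := fun σ l => A.answer S σ () (qry l)
  have hf : Measurable f := measurable_pi_iff.2 fun l => hmeas S _
  have hX : ∀ (a : Fin Q → Bool) (i : Fin Q) (σ : Seed),
      X (answerPrefix a i) (f σ) = A.answer S σ () (qry (answerPrefix a i)) :=
    fun a i σ => dif_pos (hN a i)
  let w : (N → Bool) → ℝ := fun y => A.seedLaw.real (f ⁻¹' {y})
  have hw0 : ∀ y, 0 ≤ w y := fun y => measureReal_nonneg
  have hws : ∀ s : Finset (N → Bool), ∑ y ∈ s, w y = A.seedLaw.real (f ⁻¹' s) := fun s =>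
    sum_measureReal_preimage_singleton s fun y _ => hf (measurableSet_singleton y)
  have hw1 : ∑ y, w y = 1 := by rw [hws]; simp
  have hbad : ∀ (a : Fin Q → Bool) (i : Fin Q),
      ∑ y, (if X (answerPrefix a i) y ∉ good (answerPrefix a i) then w y else 0) ≤ 0.1 := by
    intro a i
    rw [← Finset.sum_filter, hws]
    have e : f ⁻¹' (Finset.univ.filter fun y => X (answerPrefix a i) y ∉ good (answerPrefix a i) :
        Finset (N → Bool)) = {σ | A.answer S σ () (qry (answerPrefix a i)) ∈
          correctAnswers c r S (qry (answerPrefix a i))}ᶜ := by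
      ext σ
      simp [hX, good]
    have hms : MeasurableSet {σ | A.answer S σ () (qry (answerPrefix a i)) ∈
          correctAnswers c r S (qry (answerPrefix a i))} :=
      hmeas S _ (Set.toFinite _).measurableSet
    rw [e, probReal_compl_eq_one_sub hms]
    have h := ENNReal.toReal_mono (measure_ne_top _ _) (hA S (qry (answerPrefix a i)))
    rw [ENNReal.toReal_div] at h
    norm_num at h
    rw [measureReal_def]
    linarith
  let wrong : (Fin Q → Bool) → Prop := fun a => ∃ i : Fin Q, a i ∉ good (answerPrefix a i)
  let V := voteWeight (L := L) (answerProb k) X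
  have hker := isLogLipschitz_answerProb hk
  have hV0 : ∀ v l b, 0 ≤ V v l b := fun v l b => voteWeight_nonneg hker v l b
  let coinSet : (Fin L → N → Bool) → (Fin Q → Bool) → Fin Q → Set ((Fin k → Fin L) × ℝ) :=
    fun v a i => {ρ | decide ((1 / 2 : ℝ) < ((∑ j, if X (answerPrefix a i) (v (ρ.1 j)) = true
      then 1 else 0 : ℕ) : ℝ) / (k : ℝ) + ρ.2) = a i}
  -- The failure event is covered by boxes indexed by the copies' answer vectors and a wrong answer
  -- sequence. Each box has product measure, and no measurability of the failure event is needed.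
  have hcover : {ω : (Fin L → Seed) × (Fin Q → (Fin k → Fin L) × ℝ) |
        ∃ e ∈ (robustDecider A L k).play S B ω.1 (List.ofFn ω.2) [],
          e.2 ∉ correctAnswers c r S e.1} ⊆
      ⋃ v : Fin L → N → Bool, ⋃ a : {a // wrong a},
        (Set.univ.pi fun l => f ⁻¹' {v l}) ×ˢ (Set.univ.pi fun i => coinSet v a i) := by
    rintro ⟨σ, ρ⟩ ⟨e, he, hwr⟩
    obtain ⟨a, ha, ha'⟩ := exists_play_eq (robustDecider A L k) S B σ ρ []
    rw [ha] at he
    rcases mem_historyFrom B a [] e he with h | ⟨i, rfl⟩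
    · simp at h
    · refine Set.mem_iUnion₂.2 ⟨fun l => f (σ l), ⟨a, i, hwr⟩, fun l _ => rfl, fun i _ => ?_⟩
      have := ha' i
      rw [answer_robustDecider] at this
      simpa only [coinSet, Set.mem_ofPred_eq, hX] using this
  have hmeasure : ((robustDecider A L k).seedLaw.prod
        (Measure.pi fun _ : Fin Q => (robustDecider A L k).coinLaw))
      {ω | ∃ e ∈ (robustDecider A L k).play S B ω.1 (List.ofFn ω.2) [],
          e.2 ∉ correctAnswers c r S e.1} ≤
      ENNReal.ofReal (∑ v, prodWeight w v * ∑ a : Fin Q → Bool,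
        if wrong a then pathWeight (V v) a else 0) := by
    refine (measure_mono hcover).trans ((measure_iUnion_fintype_le _ _).trans ?_)
    rw [ENNReal.ofReal_sum_of_nonneg fun v _ => mul_nonneg (prodWeight_nonneg hw0 v)
      (Finset.sum_nonneg fun a _ => by split_ifs <;> simp [pathWeight_nonneg (hV0 v)])]
    refine Finset.sum_le_sum fun v _ => (measure_iUnion_fintype_le _ _).trans ?_
    rw [← Finset.sum_filter, ← Finset.sum_subtype_eq_sum_filter, Finset.mul_sum,
      ENNReal.ofReal_sum_of_nonneg fun a _ => mul_nonneg (prodWeight_nonneg hw0 v)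
        (pathWeight_nonneg (hV0 v) _)]
    rw [Finset.subtype_univ]
    refine Finset.sum_le_sum fun a _ => ?_
    rw [Measure.prod_prod, ENNReal.ofReal_mul (prodWeight_nonneg hw0 v), prodWeight, pathWeight,
      ENNReal.ofReal_prod_of_nonneg fun l _ => hw0 _,
      ENNReal.ofReal_prod_of_nonneg fun i _ => hV0 v _ _,
      Measure.pi_pi (fun _ : Fin Q => (robustDecider A L k).coinLaw)]
    refine mul_le_mul' (le_of_eq ?_) (Finset.prod_le_prod' fun i _ => ?_)
    · exact (Measure.pi_pi (fun _ : Fin L => A.seedLaw) _).trans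
        (Finset.prod_congr rfl fun l _ => (ofReal_measureReal (measure_ne_top _ _)).symm)
    · exact coinLaw_answer_le hL hk (fun l => X (answerPrefix a.1 i) (v l)) (a.1 i)
  refine hmeasure.trans (ENNReal.ofReal_le_ofReal ?_)
  have h := sum_wrong_le hw0 hw1 hL hk hm hLQ X
    (good := good) (fun l => correctAnswers_nonempty hc hr S (qry l)) (by convert hbad)
  convert h

end Robust

/-! ### The parameters of the main theorem -/

section Parameters

variable {δ : ℝ} {Q L k : ℕ}

lemma one_le_log_one_div (hδ : 0 < δ) (hδ' : δ < 1 / 400) : 1 ≤ Real.log (1 / δ) := by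
  rw [Real.le_log_iff_exp_le (by positivity), le_div_iff₀ hδ]
  nlinarith [Real.exp_one_lt_d9]

lemma log_one_div_le_log_div (hδ : 0 < δ) (hQ : 1 ≤ Q) :
    Real.log (1 / δ) ≤ Real.log (Q / δ) := by
  have : (1 : ℝ) ≤ Q := by exact_mod_cast hQ
  gcongr

lemma samples_le (h : 1 ≤ Real.log (Q / δ)) (hk : k = ⌈40 * Real.log (Q / δ)⌉₊) :
    (k : ℝ) ≤ 41 * Real.log (Q / δ) := by
  have := (Nat.ceil_lt_add_one (show 0 ≤ 40 * Real.log (Q / δ) by linarith)).le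
  rw [← hk] at this
  linarith

lemma le_copies {ε : ℝ} (hε : ε = 0.01)
    (hL : L = ⌈24 * ε⁻¹ * k * Real.sqrt (Real.log (1 / δ)) * Real.sqrt (2 * Q)⌉₊) :
    2400 * k * (Real.sqrt (Real.log (1 / δ)) * Real.sqrt (2 * Q)) ≤ L := by
  rw [hL]
  refine le_trans (le_of_eq ?_) (Nat.le_ceil _)
  rw [hε]
  ring

lemma copies_le {ε : ℝ} (hε : ε = 0.01) (hδ : 0 < δ) (hδ' : δ < 1 / 400) (hQ : 1 ≤ Q)
    (hk : k = ⌈40 * Real.log (Q / δ)⌉₊)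
    (hL : L = ⌈24 * ε⁻¹ * k * Real.sqrt (Real.log (1 / δ)) * Real.sqrt (2 * Q)⌉₊) :
    (L : ℝ) ≤ 150000 * Real.sqrt Q * Real.log (Q / δ) ^ (3 / 2 : ℝ) := by
  have hX := one_le_log_one_div hδ hδ'
  have hXl := log_one_div_le_log_div hδ hQ
  have hl : 1 ≤ Real.log (Q / δ) := hX.trans hXl
  have hQ' : (1 : ℝ) ≤ Q := by exact_mod_cast hQ
  have hc := (Nat.ceil_lt_add_one (show 0 ≤ 24 * ε⁻¹ * k * Real.sqrt (Real.log (1 / δ)) *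
    Real.sqrt (2 * Q) by rw [hε]; positivity)).le
  rw [← hL] at hc
  have h1 : 24 * ε⁻¹ * k * Real.sqrt (Real.log (1 / δ)) * Real.sqrt (2 * Q) ≤
      2400 * (41 * Real.log (Q / δ)) * Real.sqrt (Real.log (Q / δ)) * (1.5 * Real.sqrt Q) := by
    rw [Real.sqrt_mul zero_le_two]
    have h2 : Real.sqrt 2 ≤ 1.5 := Real.sqrt_le_iff.2 (by norm_num)
    have h3 := samples_le hl hk
    have h4 : 24 * ε⁻¹ = 2400 := by rw [hε]; norm_num
    rw [h4]
    gcongr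
  have e : Real.log (Q / δ) ^ (3 / 2 : ℝ) = Real.log (Q / δ) * Real.sqrt (Real.log (Q / δ)) := by
    rw [Real.sqrt_eq_rpow, ← Real.rpow_one_add' (by linarith) (by norm_num)]
    norm_num
  rw [e]
  have h5 : 1 ≤ Real.sqrt Q * (Real.log (Q / δ) * Real.sqrt (Real.log (Q / δ))) :=
    one_le_mul_of_one_le_of_one_le (Real.one_le_sqrt.2 hQ')
      (one_le_mul_of_one_le_of_one_le hl (Real.one_le_sqrt.2 hl))
  linarith

/-- With `m = ⌈40 * log (1 / δ)⌉` the privacy loss is at most `exp (0.00005 * m)`, since `L` exceeds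
`k * √(Q * log (1 / δ))` by a large constant factor. The base `0.32 / 0.33` then still leaves decay
`exp (-m / 40) ≤ δ`. The rare-round term gives `2 * δ` and the vote errors give `δ`. -/
lemma failure_bound {ε : ℝ} (hε : ε = 0.01) (hδ : 0 < δ) (hδ' : δ < 1 / 400) (hQ : 1 ≤ Q)
    (hk : k = ⌈40 * Real.log (Q / δ)⌉₊)
    (hL : L = ⌈24 * ε⁻¹ * k * Real.sqrt (Real.log (1 / δ)) * Real.sqrt (2 * Q)⌉₊) :
    0 < L ∧ 0 < k ∧ 10000 * Real.log (2 * Q) ≤ L ∧ ∃ m : ℕ, (m : ℝ) ≤ 0.01 * L ∧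
      2 * (0.32 / 0.33) ^ m * Real.exp (3 * (2 * k * (m / L)) ^ 2) ^ Q +
        Q * Real.exp (-k / 40) ≤ 3 * δ := by
  have hX := one_le_log_one_div hδ hδ'
  have hXl := log_one_div_le_log_div hδ hQ
  have hl : 1 ≤ Real.log (Q / δ) := hX.trans hXl
  have hQ' : (1 : ℝ) ≤ Q := by exact_mod_cast hQ
  have hLr := le_copies hε hL
  have hkr : 40 * Real.log (Q / δ) ≤ k := by rw [hk]; exact Nat.le_ceil _
  have hk0 : (0 : ℝ) < k := by linarith
  set x := Real.log (1 / δ) with hx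
  have hs1 : 1 ≤ Real.sqrt x * Real.sqrt (2 * Q) :=
    one_le_mul_of_one_le_of_one_le (Real.one_le_sqrt.2 hX) (Real.one_le_sqrt.2 (by linarith))
  have hLk : 2400 * k ≤ (L : ℝ) := by nlinarith
  have hL0 : (0 : ℝ) < L := by linarith
  refine ⟨by exact_mod_cast hL0, by exact_mod_cast hk0, ?_, ⌈40 * x⌉₊, ?_, ?_⟩
  · have : Real.log (2 * Q) ≤ Real.log (Q / δ) := by
      apply Real.log_le_log (by positivity)
      rw [le_div_iff₀ hδ]
      nlinarith
    linarith
  · have := (Nat.ceil_lt_add_one (show 0 ≤ 40 * x by linarith)).le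
    linarith
  · have hm1 := (Nat.ceil_lt_add_one (show 0 ≤ 40 * x by linarith)).le
    have hm2 := Nat.le_ceil (40 * x)
    set m := ⌈40 * x⌉₊
    have hfirst : Real.exp (3 * (2 * k * (m / L)) ^ 2) ^ Q ≤ Real.exp (m * 0.00005) := by
      rw [← Real.exp_nat_mul]
      apply Real.exp_le_exp.2
      have h1 : (2400 * (k : ℝ)) ^ 2 * (x * (2 * Q)) ≤ L ^ 2 := by
        have h := pow_le_pow_left₀ (by positivity) hLr 2
        rw [mul_pow, mul_pow (Real.sqrt x), Real.sq_sqrt (by linarith),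
          Real.sq_sqrt (by linarith)] at h
        exact h
      have h2 : (Q : ℝ) * (3 * (2 * k * (m / L)) ^ 2) = 12 * Q * k ^ 2 * m ^ 2 / L ^ 2 := by
        field_simp
        ring
      rw [h2, div_le_iff₀ (by positivity)]
      calc 12 * (Q : ℝ) * k ^ 2 * m ^ 2 = 12 * Q * k ^ 2 * m * m := by ring
        _ ≤ 12 * Q * k ^ 2 * m * (41 * x) := by gcongr; linarith
        -- Numerically `12 * 41 = 492`, against `0.00005 * 2400 ^ 2 * 2 = 576`.
        _ ≤ m * 0.00005 * ((2400 * (k : ℝ)) ^ 2 * (x * (2 * Q))) := by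
          have : 0 ≤ (Q : ℝ) * k ^ 2 * m * x := by positivity
          nlinarith
        _ ≤ _ := by gcongr
    have hbase : (0.32 / 0.33 : ℝ) * Real.exp 0.00005 ≤ Real.exp (-(1 / 40)) := by
      have h1 := Real.add_one_le_exp (-(1 / 40) - 0.00005)
      have h2 : Real.exp (-(1 / 40)) = Real.exp (-(1 / 40) - 0.00005) * Real.exp 0.00005 := by
        rw [← Real.exp_add]; ring_nf
      rw [h2]
      gcongr
      norm_num at h1 ⊢
      linarith
    have h1 : (0.32 / 0.33 : ℝ) ^ m * Real.exp (m * 0.00005) ≤ δ := by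
      rw [Real.exp_nat_mul, ← mul_pow]
      calc _ ≤ Real.exp (-(1 / 40)) ^ m := by gcongr
        _ ≤ Real.exp (-x) := by
          rw [← Real.exp_nat_mul]
          apply Real.exp_le_exp.2
          linarith
        _ = δ := by rw [hx, one_div, Real.log_inv, neg_neg, Real.exp_log hδ]
    have h2 : (Q : ℝ) * Real.exp (-k / 40) ≤ δ := by
      calc (Q : ℝ) * Real.exp (-k / 40) ≤ Q * Real.exp (-Real.log (Q / δ)) := by
            gcongr
            linarith
        _ = δ := by
            rw [← Real.log_inv, Real.exp_log (by positivity)]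
            field_simp
    have h3 : (0.32 / 0.33 : ℝ) ^ m * Real.exp (3 * (2 * k * (m / L)) ^ 2) ^ Q ≤
        (0.32 / 0.33 : ℝ) ^ m * Real.exp (m * 0.00005) := by gcongr
    linarith

end Parameters

end RobustANN

/-! ### The main theorem -/

theorem mainTheorem3 :
    ∃ C : ℝ, 0 < C ∧
      ∀ (M : Type*) [MetricSpace M] (Γ : Type*) (Cell : ℕ → Type*) [∀ n, Fintype (Cell n)]
        (Seed : Type*) [MeasurableSpace Seed]
        (A : RobustANN.DataStructure M Γ Cell Seed Unit)
        [MeasureTheory.IsProbabilityMeasure A.seedLaw]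
        (s t : ℕ → ℕ) (c r ε δ : ℝ) (Q L k : ℕ),
        1 < c → 0 < r → 1 ≤ Q →
        (∀ (S : Finset M) (q : M), Measurable fun σ => A.answer S σ () q) →
        A.IsObliviousDecider c r →
        (∀ n, A.space n ≤ s n) →
        (∀ (S : Finset M) (σ : Seed) (q : M), A.queryTime S σ () q ≤ t S.card) →
        ε = 0.01 → 0 < δ → δ < ε / 4 →
        k = ⌈40 * Real.log (Q / δ)⌉₊ →
        L = ⌈24 * ε⁻¹ * k * Real.sqrt (Real.log (1 / δ)) * Real.sqrt (2 * Q)⌉₊ →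
        (RobustANN.robustDecider A L k).IsAdversariallyRobust c r Q (C * δ) ∧
        (∀ n, ((RobustANN.robustDecider A L k).space n : ℝ) ≤
          s n * (C * Real.sqrt Q * Real.log (Q / δ) ^ (3 / 2 : ℝ))) ∧
        (∀ (S : Finset M) (σ : Fin L → Seed) (ρ : (Fin k → Fin L) × ℝ) (q : M),
          ((RobustANN.robustDecider A L k).queryTime S σ ρ q : ℝ) ≤
            C * t S.card * Real.log (Q / δ)) := by
  -- The space bound dictates the constant: `2400 * 41 * 1.5 = 147600`, plus one for rounding up.
  -- Failure needs only `3` and time only `41 * 4 + 3`.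
  refine ⟨150000, by norm_num, ?_⟩
  intro M _ Γ Cell _ Seed _ A _ s t c r ε δ Q L k hc hr hQ hmeas hA hs ht hε hδ hδε hk hL
  have hδ' : δ < 1 / 400 := by rw [hε] at hδε; norm_num at hδε ⊢; linarith
  have hl : 1 ≤ Real.log (Q / δ) :=
    (RobustANN.one_le_log_one_div hδ hδ').trans (RobustANN.log_one_div_le_log_div hδ hQ)
  refine ⟨?_, fun n => ?_, fun S σ ρ q => ?_⟩
  · obtain ⟨hL0, hk0, hLQ, m, hm, hb⟩ := RobustANN.failure_bound hε hδ hδ' hQ hk hL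
    intro S B
    exact (RobustANN.isAdversariallyRobust_robustDecider A hc hr hmeas hA hL0 hk0 hm hLQ S B).trans
      (ENNReal.ofReal_le_ofReal (by linarith))
  · have h1 : (RobustANN.robustDecider A L k).space n = L * A.space n := by
      simp [RobustANN.DataStructure.space]
    have h2 : (A.space n : ℝ) ≤ s n := by exact_mod_cast hs n
    rw [h1, Nat.cast_mul, mul_comm]
    exact mul_le_mul h2 (RobustANN.copies_le hε hδ hδ' hQ hk hL) (Nat.cast_nonneg _)
      (Nat.cast_nonneg _)
  · have h1 : ((RobustANN.robustDecider A L k).queryTime S σ ρ q : ℝ) ≤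
        k * (2 * t S.card + 2) + 3 := by
      exact_mod_cast RobustANN.queryTime_robustDecider_le A L k S σ ρ q fun σ => ht S σ q
    -- A program takes at least one step, and a seed exists because `seedLaw` is a probability
    -- measure. This lets the additive overheads be absorbed into `t`.
    have h2 : (1 : ℝ) ≤ t S.card := by
      obtain ⟨σ⟩ := A.seedLaw.nonempty_of_neZero
      exact_mod_cast (RobustANN.Program.one_le_time _ _).trans (ht S σ q)
    have h3 := RobustANN.samples_le hl hk
    calc _ ≤ (k : ℝ) * (2 * t S.card + 2) + 3 := h1
      _ ≤ 41 * Real.log (Q / δ) * (2 * t S.card + 2 * t S.card) +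
          3 * (t S.card * Real.log (Q / δ)) := by
        gcongr
        · linarith
        · nlinarith
      _ ≤ _ := by nlinarith [mul_nonneg (zero_le_one.trans h2) (zero_le_one.trans hl)]
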